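/- A Hermite--Biehler function is an entire function $E$ without real zeroes such that $|E(\bar z)|<|E(z)|$ for all $z$ with $\operatorname{Im} z>0$. For such $E$ put $E^\#(z)=\overline{E(\bar z)}$, $A=\frac12(E+E^\#)$, $B=\frac i2(E-E^\#)$, and let $\mathcal H(E)$ be the reproducing kernel Hilbert space of functions on $\mathbb C$ generated by the positive kernel $$K_E(z,w)=\frac{B(z)A(\bar w)-B(\bar w)A(z)}{z-\bar w}$$ (for $z=\bar w$ the quotient is understood as the limit $B'(z)A(z)-B(z)A'(z)$). For $p\in\mathbb R$ and $a>0$ let $[a\odot_p E](z)=a^pE(az)$, which is again a Hermite--Biehler function, and let $$\mathcal O_p(E)=\{a>0:\ \mathcal H(a\odot_pE)\subseteq\mathcal H(E)\text{ isometrically}\}.$$ Proposition. Let $E$ be a Hermite--Biehler function. Then the following statements hold. (i) If $\dim\mathcal H(E)>1$ and $p\in\mathbb R$ with $\mathcal O_p(E)\neq\{1\}$, then $p>-\frac12$ and $\mathcal O_p(E)\subseteq(0,1]$. (ii) If $\dim\mathcal H(E)=1$ and $p\in\mathbb R$ with $\mathcal O_p(E)\neq\{1\}$, then $p=-\frac12$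 and $\mathcal H(E)=\operatorname{span}\{1\}$. (iii) If $\mathcal H(E)=\operatorname{span}\{1\}$, then $\mathcal O_{-\frac12}(E)=(0,\infty)$. -/

import Mathlib

namespace DeBranges

open Complex MeasureTheory Filter Topology ComplexConjugate

/-! Line integrals of functions holomorphic and bounded in the closed upper half-plane. They are used
below to show that the kernel `K_E` is positive semidefinite. -/

lemma integral_eq_zero_of_decay {h : ℂ → ℂ} (hd : ∀ z : ℂ, 0 ≤ z.im → DifferentiableAt ℂ h z)
    (hi : Integrable (fun t : ℝ => h t)) {C R₀ : ℝ}
    (hC : ∀ z : ℂ, 0 ≤ z.im → R₀ ≤ ‖z‖ → ‖h z‖ ≤ C / ‖z‖ ^ 2) : ∫ t : ℝ, h t = 0 := by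
  have hlim : Tendsto (fun R : ℝ => ∫ t in (-R)..R, h (t : ℂ)) atTop (𝓝 (∫ t : ℝ, h t)) :=
    intervalIntegral_tendsto_integral hi tendsto_neg_atTop_atBot tendsto_id
  have h0 : Tendsto (fun R : ℝ => ∫ t in (-R)..R, h (t : ℂ)) atTop (𝓝 0) := by
    have hb : Tendsto (fun R : ℝ => 4 * |C| * R⁻¹) atTop (𝓝 0) := by
      simpa using tendsto_inv_atTop_zero.const_mul (4 * |C|)
    refine squeeze_zero_norm' ?_ hb
    filter_upwards [eventually_ge_atTop R₀, eventually_gt_atTop (0 : ℝ)] with R hR hR0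
    have key : ∀ z : ℂ, 0 ≤ z.im → R ≤ ‖z‖ → ‖h z‖ ≤ |C| / R ^ 2 := by
      intro z hz hRz
      refine (hC z hz (hR.trans hRz)).trans ?_
      have : (0 : ℝ) < R ^ 2 := by positivity
      gcongr
      exact le_abs_self C
    have hrect := integral_boundary_rect_eq_zero_of_differentiableOn h (-R : ℂ) (R + R * I) (by
      intro z hz
      refine (hd z ?_).differentiableWithinAt
      have := hz.2
      simp [Set.uIcc_of_le hR0.le] at this
      exact this.1)
    simp only [neg_re, ofReal_re, neg_im, ofReal_im, add_re, mul_re, I_re, mul_zero, I_im, mul_one,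
      sub_self, add_zero, add_im, mul_im, zero_add, neg_zero, ofReal_zero, zero_mul,
      smul_eq_mul] at hrect
    have e1 : ‖∫ x in (-R)..R, h (x + R * I)‖ ≤ |C| / R ^ 2 * |R - -R| := by
      refine intervalIntegral.norm_integral_le_of_norm_le_const fun x _ => key _ (by simp [hR0.le]) ?_
      simpa [abs_of_pos hR0] using abs_im_le_norm ((x : ℂ) + R * I)
    have e2 : ‖∫ y in (0 : ℝ)..R, h (R + y * I)‖ ≤ |C| / R ^ 2 * |R - 0| := by
      refine intervalIntegral.norm_integral_le_of_norm_le_const fun y hy => key _ ?_ ?_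
      · rw [Set.uIoc_of_le hR0.le] at hy; simpa using hy.1.le
      · simpa [abs_of_pos hR0] using abs_re_le_norm ((R : ℂ) + y * I)
    have e3 : ‖∫ y in (0 : ℝ)..R, h (((-R : ℝ) : ℂ) + y * I)‖ ≤ |C| / R ^ 2 * |R - 0| := by
      refine intervalIntegral.norm_integral_le_of_norm_le_const fun y hy => key _ ?_ ?_
      · rw [Set.uIoc_of_le hR0.le] at hy; simpa using hy.1.le
      · simpa [abs_of_pos hR0] using abs_re_le_norm (((-R : ℝ) : ℂ) + y * I)
    have heq : (∫ t in (-R)..R, h (t : ℂ)) = (∫ x in (-R)..R, h (x + R * I))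
        - I * (∫ y in (0 : ℝ)..R, h (R + y * I))
        + I * ∫ y in (0 : ℝ)..R, h (((-R : ℝ) : ℂ) + y * I) := by
      linear_combination hrect
    rw [heq]
    refine (norm_add_le _ _).trans ((add_le_add (norm_sub_le _ _) le_rfl).trans ?_)
    rw [norm_mul, norm_mul, norm_I, one_mul, one_mul]
    refine (add_le_add (add_le_add e1 e2) e3).trans (le_of_eq ?_)
    rw [sub_zero, sub_neg_eq_add, abs_of_pos hR0,
      abs_of_pos (show (0 : ℝ) < R + R by positivity)]
    field_simp
    ring
  exact tendsto_nhds_unique hlim h0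

lemma ofReal_sub_ne_zero {a : ℂ} (ha : a.im ≠ 0) (t : ℝ) : (t : ℂ) - a ≠ 0 := by
  intro h
  apply ha
  simpa using congrArg Complex.im h

lemma normSq_sub_inv_eq {a : ℂ} (ha : a.im ≠ 0) (t : ℝ) :
    (‖(t : ℂ) - a‖ ^ 2)⁻¹ = (a.im ^ 2)⁻¹ * (1 + (a.im⁻¹ * (t - a.re)) ^ 2)⁻¹ := by
  rw [← mul_inv, ← Complex.normSq_eq_norm_sq, Complex.normSq_apply]
  congr 1
  simp
  field_simp
  ring

lemma integrable_normSq_inv {a : ℂ} (ha : a.im ≠ 0) :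
    Integrable (fun t : ℝ => (‖(t : ℂ) - a‖ ^ 2)⁻¹) := by
  simp_rw [normSq_sub_inv_eq ha]
  exact ((integrable_inv_one_add_sq.comp_mul_left' (inv_ne_zero ha)).comp_sub_right a.re).const_mul _

lemma integral_normSq_inv {a : ℂ} (ha : 0 < a.im) :
    ∫ t : ℝ, (‖(t : ℂ) - a‖ ^ 2)⁻¹ = Real.pi / a.im := by
  simp_rw [normSq_sub_inv_eq ha.ne']
  rw [integral_const_mul,
    integral_sub_right_eq_self (fun t : ℝ => (1 + (a.im⁻¹ * t) ^ 2)⁻¹) a.re,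
    Measure.integral_comp_inv_mul_left (fun t : ℝ => (1 + t ^ 2)⁻¹), integral_univ_inv_one_add_sq,
    abs_of_pos ha, smul_eq_mul]
  field_simp

lemma integrable_inv_mul_inv {a c : ℂ} (ha : a.im ≠ 0) (hc : c.im ≠ 0) {u : ℝ → ℂ}
    (hu : Continuous u) {M : ℝ} (hM : ∀ t, ‖u t‖ ≤ M) :
    Integrable (fun t : ℝ => u t * (((t : ℂ) - a)⁻¹ * ((t : ℂ) - c)⁻¹)) := by
  refine Integrable.mono' (((integrable_normSq_inv ha).add (integrable_normSq_inv hc)).const_mul M)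
    ?_ (Eventually.of_forall fun t => ?_)
  · refine Continuous.aestronglyMeasurable ?_
    have := ofReal_sub_ne_zero ha
    have := ofReal_sub_ne_zero hc
    fun_prop (disch := assumption)
  · rw [norm_mul]
    have hM0 : 0 ≤ M := (norm_nonneg _).trans (hM t)
    refine mul_le_mul (hM t) ?_ (norm_nonneg _) hM0
    simp only [norm_mul, norm_inv, Pi.add_apply, ← inv_pow]
    nlinarith [sq_nonneg (‖(t : ℂ) - a‖⁻¹ - ‖(t : ℂ) - c‖⁻¹), sq_nonneg (‖(t : ℂ) - a‖⁻¹),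
      sq_nonneg (‖(t : ℂ) - c‖⁻¹)]

lemma decay_bound {a c z u : ℂ} {M : ℝ} (hu : ‖u‖ ≤ M) (hz : 2 * (‖a‖ + ‖c‖) + 1 ≤ ‖z‖) :
    ‖u * ((z - a)⁻¹ * (z - c)⁻¹)‖ ≤ 4 * M / ‖z‖ ^ 2 := by
  have h1 : ‖z‖ / 2 ≤ ‖z - a‖ := by
    have := norm_sub_norm_le z a
    linarith [norm_nonneg a, norm_nonneg c]
  have h2 : ‖z‖ / 2 ≤ ‖z - c‖ := by
    have := norm_sub_norm_le z c
    linarith [norm_nonneg a, norm_nonneg c]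
  have h0 : 0 < ‖z‖ := by linarith [norm_nonneg a, norm_nonneg c]
  have hM0 : 0 ≤ M := (norm_nonneg _).trans hu
  rw [norm_mul, norm_mul, norm_inv, norm_inv]
  calc ‖u‖ * (‖z - a‖⁻¹ * ‖z - c‖⁻¹) ≤ M * ((‖z‖ / 2)⁻¹ * (‖z‖ / 2)⁻¹) := by gcongr
    _ = _ := by field_simp; ring

lemma integral_of_im_neg {θ : ℂ → ℂ} (hd : ∀ z : ℂ, 0 ≤ z.im → DifferentiableAt ℂ θ z) {M : ℝ}
    (hM : ∀ z : ℂ, 0 ≤ z.im → ‖θ z‖ ≤ M) {a c : ℂ} (ha : a.im < 0) (hc : c.im < 0) :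
    ∫ t : ℝ, θ t * (((t : ℂ) - a)⁻¹ * ((t : ℂ) - c)⁻¹) = 0 := by
  have hcont : Continuous fun t : ℝ => θ t := continuous_iff_continuousAt.2 fun t =>
    ((hd t (by simp)).continuousAt).comp Complex.continuous_ofReal.continuousAt
  refine integral_eq_zero_of_decay (h := fun z => θ z * ((z - a)⁻¹ * (z - c)⁻¹)) ?_
    (integrable_inv_mul_inv ha.ne hc.ne hcont fun t => hM t (by simp))
    (fun z hz hR => decay_bound (hM z hz) hR)
  intro z hz
  have h1 : z - a ≠ 0 := fun h => by
    have := congrArg Complex.im h; simp at this; linarith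
  have h2 : z - c ≠ 0 := fun h => by
    have := congrArg Complex.im h; simp at this; linarith
  exact (hd z hz).mul (((differentiableAt_id.sub_const a).inv h1).mul
    ((differentiableAt_id.sub_const c).inv h2))

lemma integral_inv_mul_inv {a c : ℂ} (ha : 0 < a.im) (hc : c.im < 0) :
    ∫ t : ℝ, ((t : ℂ) - a)⁻¹ * ((t : ℂ) - c)⁻¹ = 2 * Real.pi * I / (a - c) := by
  have hac : a - c ≠ 0 := fun h => by
    have := congrArg Complex.im h; simp at this; linarith
  have hca : (conj a).im < 0 := by simpa using ha
  have h0 : ∫ t : ℝ, ((t : ℂ) - conj a)⁻¹ * ((t : ℂ) - c)⁻¹ = 0 := by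
    simpa using integral_of_im_neg (θ := fun _ => 1) (M := 1) (fun z _ => by fun_prop)
      (fun z _ => by simp) hca hc
  have h1 : ∫ t : ℝ, ((t : ℂ) - a)⁻¹ * ((t : ℂ) - conj a)⁻¹ = Real.pi / a.im := by
    rw [← ofReal_div, ← integral_normSq_inv ha, ← integral_complex_ofReal]
    congr 1
    ext t
    rw [← mul_inv, ofReal_inv, ← Complex.normSq_eq_norm_sq, Complex.normSq_eq_conj_mul_self]
    simp [mul_comm]
  have i0 := integrable_inv_mul_inv hca.ne hc.ne (u := fun _ => 1) continuous_const (M := 1)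
    (by simp)
  have i1 := integrable_inv_mul_inv ha.ne' hca.ne (u := fun _ => 1) continuous_const (M := 1)
    (by simp)
  simp only [one_mul] at i0 i1
  have hpt : ∀ t : ℝ, ((t : ℂ) - a)⁻¹ * ((t : ℂ) - c)⁻¹
      = (a - conj a) / (a - c) * (((t : ℂ) - a)⁻¹ * ((t : ℂ) - conj a)⁻¹)
        + (conj a - c) / (a - c) * (((t : ℂ) - conj a)⁻¹ * ((t : ℂ) - c)⁻¹) := by
    intro t
    have e1 := ofReal_sub_ne_zero ha.ne' t
    have e2 := ofReal_sub_ne_zero hc.ne t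
    have e3 := ofReal_sub_ne_zero hca.ne t
    field_simp
    ring
  simp_rw [hpt]
  rw [integral_add (i1.const_mul _) (i0.const_mul _), integral_const_mul, integral_const_mul, h0, h1,
    Complex.sub_conj]
  have : (a.im : ℂ) ≠ 0 := by exact_mod_cast ha.ne'
  push_cast
  field_simp
  ring

lemma integral_of_im_pos {θ : ℂ → ℂ} (hd : ∀ z : ℂ, 0 ≤ z.im → DifferentiableAt ℂ θ z) {M : ℝ}
    (hM : ∀ z : ℂ, 0 ≤ z.im → ‖θ z‖ ≤ M) {a c : ℂ} (ha : 0 < a.im) (hc : c.im < 0) :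
    ∫ t : ℝ, θ t * (((t : ℂ) - a)⁻¹ * ((t : ℂ) - c)⁻¹) = 2 * Real.pi * I * θ a / (a - c) := by
  have hcont : Continuous fun t : ℝ => θ t := continuous_iff_continuousAt.2 fun t =>
    ((hd t (by simp)).continuousAt).comp Complex.continuous_ofReal.continuousAt
  have hM' : ∀ z : ℂ, 0 ≤ z.im → ‖θ z - θ a‖ ≤ M + M := fun z hz =>
    (norm_sub_le _ _).trans (add_le_add (hM z hz) (hM a ha.le))
  have i1 : Integrable fun t : ℝ => (θ t - θ a) * (((t : ℂ) - a)⁻¹ * ((t : ℂ) - c)⁻¹) :=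
    integrable_inv_mul_inv ha.ne' hc.ne (hcont.sub continuous_const) fun t => hM' t (by simp)
  have i2 := integrable_inv_mul_inv ha.ne' hc.ne (continuous_const (y := θ a)) (M := ‖θ a‖)
    fun t => le_rfl
  have hds : ∀ z : ℂ, z ≠ a → dslope θ a z * (z - c)⁻¹
      = (θ z - θ a) * ((z - a)⁻¹ * (z - c)⁻¹) := by
    intro z hz
    rw [dslope_of_ne _ hz, slope_def_field, div_eq_mul_inv, mul_assoc]
  have hta : ∀ t : ℝ, (t : ℂ) ≠ a := fun t h => ofReal_sub_ne_zero ha.ne' t (sub_eq_zero.2 h)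
  have h0 : ∫ t : ℝ, (θ t - θ a) * (((t : ℂ) - a)⁻¹ * ((t : ℂ) - c)⁻¹) = 0 := by
    rw [← integral_eq_zero_of_decay (h := fun z => dslope θ a z * (z - c)⁻¹) (C := 4 * (M + M))
      (R₀ := 2 * (‖a‖ + ‖c‖) + 1)]
    · congr 1; ext t; exact (hds t (hta t)).symm
    · intro z hz
      have h2 : z - c ≠ 0 := fun h => by
        have := congrArg Complex.im h; simp at this; linarith
      refine DifferentiableAt.mul ?_ ((differentiableAt_id.sub_const c).inv h2)
      by_cases hza : z = a
      · subst hza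
        have hopen : {w : ℂ | 0 < w.im} ∈ 𝓝 z := (isOpen_lt continuous_const continuous_im).mem_nhds ha
        exact ((differentiableOn_dslope hopen).2
          fun w hw => (hd w (le_of_lt hw)).differentiableWithinAt).differentiableAt hopen
      · exact (differentiableAt_dslope_of_ne hza).2 (hd z hz)
    · refine i1.congr (Eventually.of_forall fun t => ?_)
      exact (hds t (hta t)).symm
    · intro z hz hR
      have hza : z ≠ a := by
        rintro rfl
        linarith [norm_nonneg z, norm_nonneg c]
      rw [hds z hza]
      exact decay_bound (hM' z hz) hR
  have : ∀ t : ℝ, θ t * (((t : ℂ) - a)⁻¹ * ((t : ℂ) - c)⁻¹)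
      = (θ t - θ a) * (((t : ℂ) - a)⁻¹ * ((t : ℂ) - c)⁻¹)
        + θ a * (((t : ℂ) - a)⁻¹ * ((t : ℂ) - c)⁻¹) := fun t => by ring
  simp_rw [this]
  rw [integral_add i1 i2, h0, integral_const_mul, integral_inv_mul_inv ha hc]
  ring

lemma integral_general {θ : ℂ → ℂ} (hd : ∀ z : ℂ, 0 ≤ z.im → DifferentiableAt ℂ θ z) {M : ℝ}
    (hM : ∀ z : ℂ, 0 ≤ z.im → ‖θ z‖ ≤ M) {a b : ℂ} (ha : a.im ≠ 0) (hb : b.im ≠ 0) (hab : a ≠ b) :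
    ∫ t : ℝ, θ t * (((t : ℂ) - a)⁻¹ * ((t : ℂ) - b)⁻¹)
      = 2 * Real.pi * I * ((if 0 < a.im then θ a else 0) - (if 0 < b.im then θ b else 0)) / (a - b) := by
  have hcont : Continuous fun t : ℝ => θ t := continuous_iff_continuousAt.2 fun t =>
    ((hd t (by simp)).continuousAt).comp Complex.continuous_ofReal.continuousAt
  have hI : (-I).im < 0 := by simp
  have hG : ∀ a : ℂ, a.im ≠ 0 →
      (a - -I) * ∫ t : ℝ, θ t * (((t : ℂ) - a)⁻¹ * ((t : ℂ) - -I)⁻¹)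
        = 2 * Real.pi * I * (if 0 < a.im then θ a else 0) := by
    intro a ha
    rcases lt_or_gt_of_ne ha with h | h
    · rw [integral_of_im_neg hd hM h hI, if_neg (not_lt.2 h.le)]; simp
    · rw [integral_of_im_pos hd hM h hI, if_pos h]
      have : a - -I ≠ 0 := fun e => by
        have := congrArg Complex.im e; simp at this; linarith
      field_simp
  have hab' : a - b ≠ 0 := sub_ne_zero.2 hab
  have hpt : ∀ t : ℝ, θ t * (((t : ℂ) - a)⁻¹ * ((t : ℂ) - b)⁻¹)
      = (a - b)⁻¹ * ((a - -I) * (θ t * (((t : ℂ) - a)⁻¹ * ((t : ℂ) - -I)⁻¹))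
        - (b - -I) * (θ t * (((t : ℂ) - b)⁻¹ * ((t : ℂ) - -I)⁻¹))) := by
    intro t
    have e1 := ofReal_sub_ne_zero ha t
    have e2 := ofReal_sub_ne_zero hb t
    have e3 := ofReal_sub_ne_zero hI.ne t
    field_simp
    ring
  simp_rw [hpt]
  rw [integral_const_mul, integral_sub, integral_const_mul, integral_const_mul, hG a ha, hG b hb]
  · field_simp
  · exact (integrable_inv_mul_inv ha hI.ne hcont fun t => hM t (by simp)).const_mul _
  · exact (integrable_inv_mul_inv hb hI.ne hcont fun t => hM t (by simp)).const_mul _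


/-- The function `F^#(z) = conj (F (conj z))`. -/
def sharp (F : ℂ → ℂ) : ℂ → ℂ := fun z => conj (F (conj z))

/-- A Hermite-Biehler function: an entire function `E` with `|E(conj z)| < |E(z)|` for all `z` in the
open upper half-plane, and without real zeroes. -/
structure HermiteBiehler where
  toFun : ℂ → ℂ
  entire : Differentiable ℂ toFun
  norm_conj_lt : ∀ z : ℂ, 0 < z.im → ‖toFun (conj z)‖ < ‖toFun z‖
  real_ne_zero : ∀ t : ℝ, toFun t ≠ 0

/-- `A = (E + E^#) / 2`. -/
noncomputable def partA (E : ℂ → ℂ) : ℂ → ℂ := fun z => (E z + sharp E z) / 2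

/-- `B = i (E - E^#) / 2`, so that `E = A - i B`. -/
noncomputable def partB (E : ℂ → ℂ) : ℂ → ℂ := fun z => I / 2 * (E z - sharp E z)

open Classical in
/-- The kernel `K_E(z, w) = (B(z) A(conj w) - B(conj w) A(z)) / (z - conj w)`; for `z = conj w` the
quotient is the limit `B'(z) A(z) - B(z) A'(z)`. -/
noncomputable def kernelFun (E : ℂ → ℂ) (z w : ℂ) : ℂ :=
  if z = conj w then deriv (partB E) z * partA E z - partB E z * deriv (partA E) z
  else (partB E z * partA E (conj w) - partB E (conj w) * partA E z) / (z - conj w)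

lemma sharp_differentiable {E : ℂ → ℂ} (hE : Differentiable ℂ E) : Differentiable ℂ (sharp E) :=
  fun _ => differentiableAt_conj_conj_iff.2 (hE _)

lemma partA_differentiable {E : ℂ → ℂ} (hE : Differentiable ℂ E) : Differentiable ℂ (partA E) :=
  (hE.add (sharp_differentiable hE)).div_const 2

lemma partB_differentiable {E : ℂ → ℂ} (hE : Differentiable ℂ E) : Differentiable ℂ (partB E) :=
  (hE.sub (sharp_differentiable hE)).const_mul _

lemma sharp_conj (F : ℂ → ℂ) (z : ℂ) : sharp F (conj z) = conj (F z) := by simp [sharp]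

lemma partA_conj (E : ℂ → ℂ) (z : ℂ) : partA E (conj z) = conj (partA E z) := by
  simp only [partA, sharp, conj_conj, map_div₀, map_add, map_ofNat]
  ring

lemma partB_conj (E : ℂ → ℂ) (z : ℂ) : partB E (conj z) = conj (partB E z) := by
  simp only [partB, sharp, conj_conj, map_div₀, map_mul, map_sub, map_ofNat, conj_I]
  ring

lemma deriv_conj_of_conj {F : ℂ → ℂ} (h : ∀ z, F (conj z) = conj (F z)) (z : ℂ) :
    deriv F (conj z) = conj (deriv F z) := by
  have : F = conj ∘ F ∘ conj := by ext w; simp [h]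
  conv_lhs => rw [this]
  rw [deriv_conj_conj]
  simp

lemma kernelFun_conj (E : ℂ → ℂ) (z w : ℂ) : conj (kernelFun E z w) = kernelFun E w z := by
  unfold kernelFun
  by_cases h : z = conj w
  · have h' : w = conj z := by simp [h]
    rw [if_pos h, if_pos h', h', deriv_conj_of_conj (partA_conj E), deriv_conj_of_conj (partB_conj E),
      partA_conj, partB_conj]
    simp
  · have h' : w ≠ conj z := fun e => h (by simp [e])
    rw [if_neg h, if_neg h']
    simp only [map_div₀, map_sub, map_mul, partA_conj, partB_conj, conj_conj]
    rw [← neg_sub, ← neg_sub (w : ℂ), neg_div_neg_eq]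

/-- The kernel in terms of `E`. -/
lemma kernelFun_of_ne (E : ℂ → ℂ) {z w : ℂ} (h : z ≠ conj w) :
    kernelFun E z w
      = I / 2 * (E z * conj (E w) - sharp E z * conj (sharp E w)) / (z - conj w) := by
  rw [kernelFun, if_neg h]
  congr 1
  have : E (conj w) = conj (sharp E w) := by simp [sharp]
  simp only [partA, partB, this, sharp_conj]
  ring

/-- The kernel is jointly continuous along nonsingular approach. -/
lemma kernelFun_tendsto {E : ℂ → ℂ} (hE : Differentiable ℂ E) {l : Filter ℝ} {f g : ℝ → ℂ} {z w : ℂ}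
    (hf : Tendsto f l (𝓝 z)) (hg : Tendsto g l (𝓝 w)) (hne : ∀ᶠ s in l, f s ≠ conj (g s)) :
    Tendsto (fun s => kernelFun E (f s) (g s)) l (𝓝 (kernelFun E z w)) := by
  have hA := partA_differentiable hE
  have hB := partB_differentiable hE
  have hg' : Tendsto (fun s => conj (g s)) l (𝓝 (conj w)) :=
    (Complex.continuous_conj.tendsto w).comp hg
  by_cases h : z = conj w
  · have slope : ∀ F : ℂ → ℂ, Differentiable ℂ F →
        Tendsto (fun s => (F (f s) - F (conj (g s))) / (f s - conj (g s))) l (𝓝 (deriv F z)) := by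
      intro F hF
      have hst : HasStrictDerivAt F (deriv F z) z :=
        (hF.analyticAt z).hasStrictDerivAt
      have := hst.isLittleO.comp_tendsto (hf.prodMk_nhds (h ▸ hg'))
      have h2 := this.tendsto_div_nhds_zero
      have h3 := h2.add_const (deriv F z)
      rw [zero_add] at h3
      refine h3.congr' ?_
      filter_upwards [hne] with s hs
      have : f s - conj (g s) ≠ 0 := sub_ne_zero.2 hs
      simp
      field_simp
      ring
    rw [kernelFun, if_pos h]
    have e1 := ((slope _ hB).mul ((hA.continuous.tendsto _).comp hg')).sub
      (((hB.continuous.tendsto _).comp hg').mul (slope _ hA))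
    rw [← h] at e1
    refine e1.congr' ?_
    filter_upwards [hne] with s hs
    rw [kernelFun, if_neg hs]
    have : f s - conj (g s) ≠ 0 := sub_ne_zero.2 hs
    simp only [Function.comp]
    field_simp
    ring
  · rw [kernelFun, if_neg h]
    have e1 := ((((hB.continuous.tendsto _).comp hf).mul ((hA.continuous.tendsto _).comp hg')).sub
      (((hB.continuous.tendsto _).comp hg').mul ((hA.continuous.tendsto _).comp hf))).div
      (hf.sub hg') (sub_ne_zero.2 h)
    refine e1.congr' ?_
    filter_upwards [hne] with s hs
    rw [kernelFun, if_neg hs]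
    rfl

namespace HermiteBiehler

variable (E : HermiteBiehler)

lemma ne_zero {z : ℂ} (hz : 0 ≤ z.im) : E.toFun z ≠ 0 := by
  rcases hz.eq_or_lt with h | h
  · have : z = (z.re : ℂ) := Complex.ext rfl (by simp [← h])
    rw [this]
    exact E.real_ne_zero _
  · have := E.norm_conj_lt z h
    exact norm_pos_iff.1 ((norm_nonneg _).trans_lt this)

/-- The quotient `E^# / E`. -/
noncomputable def theta : ℂ → ℂ := fun z => sharp E.toFun z / E.toFun z

lemma theta_differentiableAt {z : ℂ} (hz : 0 ≤ z.im) : DifferentiableAt ℂ E.theta z :=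
  (sharp_differentiable E.entire z).div (E.entire z) (E.ne_zero hz)

lemma norm_theta_le {z : ℂ} (hz : 0 ≤ z.im) : ‖E.theta z‖ ≤ 1 := by
  rw [theta, norm_div, div_le_one (norm_pos_iff.2 (E.ne_zero hz)), sharp, RCLike.norm_conj]
  rcases hz.eq_or_lt with h | h
  · rw [show conj z = z from Complex.conj_eq_iff_im.2 h.symm]
  · exact (E.norm_conj_lt z h).le

lemma theta_mul {z : ℂ} (hz : 0 ≤ z.im) : E.theta z * E.toFun z = sharp E.toFun z :=
  div_mul_cancel₀ _ (E.ne_zero hz)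

lemma continuous_theta : Continuous fun t : ℝ => E.theta t := continuous_iff_continuousAt.2 fun t =>
  (E.theta_differentiableAt (by simp)).continuousAt.comp Complex.continuous_ofReal.continuousAt

lemma theta_real (t : ℝ) : E.theta t * conj (E.theta t) = 1 := by
  have h1 := E.real_ne_zero t
  have h2 : conj (E.toFun t) ≠ 0 := by simpa using h1
  simp [theta, sharp]
  field_simp

/-- The function `t ↦ K_E(t, w) / E(t)` on the real line, for nonreal `w`. -/
noncomputable def gram (w : ℂ) (t : ℝ) : ℂ :=
  I / 2 * (conj (E.toFun w) - E.theta t * conj (sharp E.toFun w)) * ((t : ℂ) - conj w)⁻¹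

lemma gram_mul_conj {z w : ℂ} (t : ℝ) :
    E.gram w t * conj (E.gram z t)
      = 1 / 4 * ((conj (E.toFun w) * E.toFun z + conj (sharp E.toFun w) * sharp E.toFun z)
            * (1 * (((t : ℂ) - conj w)⁻¹ * ((t : ℂ) - z)⁻¹))
          - conj (sharp E.toFun w) * E.toFun z
            * (E.theta t * (((t : ℂ) - conj w)⁻¹ * ((t : ℂ) - z)⁻¹))
          - conj (E.toFun w) * sharp E.toFun z
            * conj (E.theta t * (((t : ℂ) - w)⁻¹ * ((t : ℂ) - conj z)⁻¹))) := by
  have h := E.theta_real t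
  simp only [gram, map_mul, map_sub, map_div₀, conj_I, map_ofNat, map_inv₀, conj_ofReal, conj_conj]
  linear_combination (exp := 1) (1 / 4 * conj (sharp E.toFun w) * sharp E.toFun z *
    ((t : ℂ) - conj w)⁻¹ * ((t : ℂ) - z)⁻¹) * h - (1 / 4) * (conj (E.toFun w) - E.theta t * conj (sharp E.toFun w)) * ((t : ℂ) - conj w)⁻¹ *
    (E.toFun z - conj (E.theta t) * sharp E.toFun z) * ((t : ℂ) - z)⁻¹ * (I_sq)

lemma integrable_gram {z w : ℂ} (hz : z.im ≠ 0) (hw : w.im ≠ 0) :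
    Integrable fun t : ℝ => E.gram w t * conj (E.gram z t) := by
  have hw' : (conj w).im ≠ 0 := by simpa using hw
  have hz' : (conj z).im ≠ 0 := by simpa using hz
  simp_rw [gram_mul_conj]
  have b : ∀ t : ℝ, ‖E.theta t‖ ≤ 1 := fun t => E.norm_theta_le (by simp)
  have i1 := integrable_inv_mul_inv hw' hz (continuous_const (y := (1 : ℂ))) (M := 1) (by simp)
  have i2 := integrable_inv_mul_inv hw' hz E.continuous_theta b
  have i3 := (integrable_inv_mul_inv hw hz' E.continuous_theta b)
  have i3' : Integrable fun t : ℝ => conj (E.theta t * (((t : ℂ) - w)⁻¹ * ((t : ℂ) - conj z)⁻¹)) :=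
    Complex.conjCLE.toContinuousLinearMap.integrable_comp i3
  exact (((i1.const_mul _).sub (i2.const_mul _)).sub (i3'.const_mul _)).const_mul _

lemma integral_gram {z w : ℂ} (hz : z.im ≠ 0) (hw : w.im ≠ 0) (hzw : z ≠ conj w) :
    ∫ t : ℝ, E.gram w t * conj (E.gram z t) = Real.pi * kernelFun E.toFun z w := by
  have hw' : (conj w).im ≠ 0 := by simpa using hw
  have hz' : (conj z).im ≠ 0 := by simpa using hz
  have hwz : w ≠ conj z := fun e => hzw (by simp [e])
  simp_rw [gram_mul_conj]
  have b : ∀ t : ℝ, ‖E.theta t‖ ≤ 1 := fun t => E.norm_theta_le (by simp)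
  have i1 := integrable_inv_mul_inv hw' hz (continuous_const (y := (1 : ℂ))) (M := 1) (by simp)
  have i2 := integrable_inv_mul_inv hw' hz E.continuous_theta b
  have i3 := (integrable_inv_mul_inv hw hz' E.continuous_theta b)
  have i3' : Integrable fun t : ℝ => conj (E.theta t * (((t : ℂ) - w)⁻¹ * ((t : ℂ) - conj z)⁻¹)) :=
    Complex.conjCLE.toContinuousLinearMap.integrable_comp i3
  have j1 := (i1.const_mul (conj (E.toFun w) * E.toFun z + conj (sharp E.toFun w) * sharp E.toFun z))
  have j2 := i2.const_mul (conj (sharp E.toFun w) * E.toFun z)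
  have j3 := i3'.const_mul (conj (E.toFun w) * sharp E.toFun z)
  have j12 := j1.sub j2
  simp only [Pi.sub_def] at j12
  rw [integral_const_mul, integral_sub j12 j3, integral_sub j1 j2,
    integral_const_mul (conj (E.toFun w) * E.toFun z + conj (sharp E.toFun w) * sharp E.toFun z),
    integral_const_mul (conj (sharp E.toFun w) * E.toFun z),
    integral_const_mul (conj (E.toFun w) * sharp E.toFun z), integral_conj,
    integral_general (θ := fun _ => 1) (M := 1) (fun _ _ => by fun_prop) (by simp) hw' hz hzw.symm,
    integral_general (fun _ h => E.theta_differentiableAt h) (fun _ h => E.norm_theta_le h) hw' hz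
      hzw.symm,
    integral_general (fun _ h => E.theta_differentiableAt h) (fun _ h => E.norm_theta_le h) hw hz'
      hwz, kernelFun_of_ne _ hzw]
  have d1 : conj w - z ≠ 0 := sub_ne_zero.2 hzw.symm
  have d2 : z - conj w ≠ 0 := sub_ne_zero.2 hzw
  have d3 : -z + conj w ≠ 0 := by rwa [neg_add_eq_sub]
  have tp : ∀ v : ℂ, 0 < v.im → sharp E.toFun v = E.theta v * E.toFun v :=
    fun v h => (E.theta_mul h.le).symm
  have tn : ∀ v : ℂ, v.im < 0 → E.toFun v = conj (E.theta (conj v)) * sharp E.toFun v := by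
    intro v h
    have h1 : sharp E.toFun (conj v) = conj (E.toFun v) := sharp_conj _ _
    have h2 : E.toFun (conj v) = conj (sharp E.toFun v) := by simp [sharp]
    have h3 := E.theta_mul (z := conj v) (by simpa using h.le)
    rw [h1, h2] at h3
    simpa using (congrArg conj h3).symm
  rcases lt_or_gt_of_ne hz with h1 | h1 <;> rcases lt_or_gt_of_ne hw with h2 | h2 <;>
    simp only [conj_im, Left.neg_pos_iff, h1, h2, not_lt.2 h1.le, not_lt.2 h2.le, if_true, if_false,
      map_div₀, map_mul, map_sub, conj_I, conj_conj, map_zero, map_ofNat, conj_ofReal]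
  · rw [tn z h1, tn w h2]
    simp only [map_mul, conj_conj]
    field_simp
    ring
  · rw [tn z h1, tp w h2]
    simp only [map_mul]
    field_simp
    ring
  · rw [tp z h1, tn w h2]
    simp only [map_mul, conj_conj]
    field_simp
    ring
  · rw [tp z h1, tp w h2]
    simp only [map_mul]
    field_simp
    ring

lemma sum_nonneg_of_im_ne_zero (s : Finset ℂ) (p c : ℂ → ℂ) (hp : ∀ x ∈ s, (p x).im ≠ 0)
    (hne : ∀ x ∈ s, ∀ y ∈ s, p x ≠ conj (p y)) :
    0 ≤ (∑ x ∈ s, ∑ y ∈ s, c y * conj (c x) * kernelFun E.toFun (p x) (p y)).re := by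
  have hint : ∀ x ∈ s, ∀ y ∈ s, Integrable fun t : ℝ =>
      c y * conj (c x) * (E.gram (p y) t * conj (E.gram (p x) t)) := fun x hx y hy =>
    (E.integrable_gram (hp x hx) (hp y hy)).const_mul _
  have h1 : ∫ t : ℝ, ((‖∑ x ∈ s, c x * E.gram (p x) t‖ ^ 2 : ℝ) : ℂ)
      = Real.pi * ∑ x ∈ s, ∑ y ∈ s, c y * conj (c x) * kernelFun E.toFun (p x) (p y) := by
    have hpt : ∀ t : ℝ, ((‖∑ x ∈ s, c x * E.gram (p x) t‖ ^ 2 : ℝ) : ℂ)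
        = ∑ x ∈ s, ∑ y ∈ s, c y * conj (c x) * (E.gram (p y) t * conj (E.gram (p x) t)) := by
      intro t
      rw [← Complex.normSq_eq_norm_sq, Complex.normSq_eq_conj_mul_self, map_sum, Finset.sum_mul_sum]
      refine Finset.sum_congr rfl fun x _ => Finset.sum_congr rfl fun y _ => ?_
      rw [map_mul]
      ring
    simp_rw [hpt]
    rw [integral_finsetSum _ fun x hx => integrable_finsetSum _ fun y hy => hint x hx y hy,
      Finset.mul_sum]
    refine Finset.sum_congr rfl fun x hx => ?_
    rw [integral_finsetSum _ fun y hy => hint x hx y hy, Finset.mul_sum]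
    refine Finset.sum_congr rfl fun y hy => ?_
    rw [integral_const_mul, E.integral_gram (hp x hx) (hp y hy) (hne x hx y hy)]
    ring
  rw [integral_complex_ofReal] at h1
  have h2 := congrArg Complex.re h1
  rw [ofReal_re, re_ofReal_mul] at h2
  have h3 : 0 ≤ ∫ t : ℝ, ‖∑ x ∈ s, c x * E.gram (p x) t‖ ^ 2 :=
    integral_nonneg fun t => by positivity
  rw [h2] at h3
  exact nonneg_of_mul_nonneg_right h3 Real.pi_pos

lemma sum_nonneg (s : Finset ℂ) (c : ℂ → ℂ) :
    0 ≤ (∑ x ∈ s, ∑ y ∈ s, c y * conj (c x) * kernelFun E.toFun x y).re := by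
  have hsh : ∀ x : ℂ, Tendsto (fun r : ℝ => x + r * I) (𝓝[>] 0) (𝓝 x) := by
    intro x
    have : Continuous fun r : ℝ => x + r * I := by fun_prop
    simpa using (this.tendsto 0).mono_left nhdsWithin_le_nhds
  have hev : ∀ u : ℝ, ∀ᶠ r : ℝ in 𝓝[>] 0, u + r ≠ 0 := by
    intro u
    rcases lt_or_ge u 0 with h | h
    · filter_upwards [nhdsWithin_le_nhds (Iio_mem_nhds (neg_pos.2 h))] with r hr
      have := Set.mem_Iio.1 hr
      linarith
    · filter_upwards [self_mem_nhdsWithin] with r hr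
      have := Set.mem_Ioi.1 hr
      linarith
  have hne : ∀ x y : ℂ, ∀ᶠ r : ℝ in 𝓝[>] 0, x + r * I ≠ conj (y + r * I) := by
    intro x y
    filter_upwards [hev ((x.im + y.im) / 2)] with r hr h
    have := congrArg Complex.im h
    simp at this
    apply hr
    linarith
  have hlim : Tendsto (fun r : ℝ => (∑ x ∈ s, ∑ y ∈ s,
      c y * conj (c x) * kernelFun E.toFun (x + r * I) (y + r * I)).re) (𝓝[>] 0)
      (𝓝 (∑ x ∈ s, ∑ y ∈ s, c y * conj (c x) * kernelFun E.toFun x y).re) := by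
    refine (Complex.continuous_re.tendsto _).comp (tendsto_finsetSum _ fun x _ =>
      tendsto_finsetSum _ fun y _ => ?_)
    exact (kernelFun_tendsto E.entire (hsh x) (hsh y) (hne x y)).const_mul _
  refine ge_of_tendsto hlim ?_
  have e1 : ∀ᶠ r : ℝ in 𝓝[>] 0, ∀ x ∈ s, (x + r * I).im ≠ 0 := by
    rw [Filter.eventually_all_finset]
    intro x _
    filter_upwards [hev x.im] with r hr
    simpa using hr
  have e2 : ∀ᶠ r : ℝ in 𝓝[>] 0, ∀ x ∈ s, ∀ y ∈ s, x + r * I ≠ conj (y + r * I) := by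
    rw [Filter.eventually_all_finset]
    intro x _
    rw [Filter.eventually_all_finset]
    intro y _
    exact hne x y
  filter_upwards [e1, e2] with r h1 h2
  exact E.sum_nonneg_of_im_ne_zero s (fun x => x + r * I) c h1 h2

/-- The kernel `K_E` as a matrix of operators on `ℂ`. -/
noncomputable def kernel : Matrix ℂ ℂ (ℂ →L[ℂ] ℂ) :=
  .of fun z w => kernelFun E.toFun z w • ContinuousLinearMap.id ℂ ℂ

/-- `K_E` is a positive kernel. -/
theorem posSemidef_kernel : E.kernel.PosSemidef := by
  have htfae := (RKHS.posSemidef_tfae (K := E.kernel)).out 0 2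
  refine htfae.2 ⟨?_, fun v => ?_⟩
  · ext z w
    rw [Matrix.conjTranspose_apply, kernel, Matrix.of_apply, Matrix.of_apply, star_smul,
      ← ContinuousLinearMap.one_def, star_one]
    simp [kernelFun_conj]
  · convert! E.sum_nonneg v.support v using 1
    simp only [Finsupp.sum, kernel, Matrix.of_apply]
    refine congrArg Complex.re
      (Finset.sum_congr rfl fun x _ => Finset.sum_congr rfl fun y _ => ?_)
    simp [← kernelFun_conj E.toFun x y]
    ring

instance : Fact E.kernel.PosSemidef := ⟨E.posSemidef_kernel⟩

/-- The de Branges space `H(E)`: the reproducing kernel Hilbert space generated by `K_E`. -/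
abbrev Space : Type := RKHS.OfKernel E.kernel

/-- The entire functions that make up `H(E)`. -/
def functions : Set (ℂ → ℂ) := Set.range fun F : E.Space => (F : ℂ → ℂ)

/-- `H(E₁) ⊆ H(E₂)` isometrically: each element of `H(E₁)` belongs, as a function on `ℂ`, to
`H(E₂)`, with the same norm. -/
def IsometricSubspace (E₁ E₂ : HermiteBiehler) : Prop :=
  ∀ F : E₁.Space, ∃ G : E₂.Space, (G : ℂ → ℂ) = (F : ℂ → ℂ) ∧ ‖G‖ = ‖F‖

end HermiteBiehler

/-- The weighted rescaling `[a ⊙_p F](z) = a ^ p F(a z)`. -/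
noncomputable def weightedRescale (p a : ℝ) (F : ℂ → ℂ) : ℂ → ℂ :=
  fun z => ((a ^ p : ℝ) : ℂ) * F (a * z)

/-- For `a > 0` the rescaled function `a ⊙_p E` is again Hermite-Biehler. -/
noncomputable def HermiteBiehler.rescale (p : ℝ) {a : ℝ} (ha : 0 < a) (E : HermiteBiehler) :
    HermiteBiehler where
  toFun := weightedRescale p a E.toFun
  entire := (E.entire.comp (differentiable_id.const_mul _)).const_mul _
  norm_conj_lt z hz := by
    have h1 : (a : ℂ) * conj z = conj (a * z) := by simp
    have h2 : 0 < ((a : ℂ) * z).im := by simpa using mul_pos ha hz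
    simp only [weightedRescale, norm_mul, h1]
    refine mul_lt_mul_of_pos_left (E.norm_conj_lt _ h2) ?_
    rw [Complex.norm_real]
    exact norm_pos_iff.2 (Real.rpow_pos_of_pos ha p).ne'
  real_ne_zero t := by
    have := E.real_ne_zero (a * t)
    push_cast at this
    exact mul_ne_zero (by exact_mod_cast (Real.rpow_pos_of_pos ha p).ne') this

/-- `O_p(E)`: the set of all `a > 0` such that `H(a ⊙_p E) ⊆ H(E)` isometrically. -/
def isometricScales (p : ℝ) (E : HermiteBiehler) : Set ℝ :=
  {a | ∃ ha : 0 < a, (E.rescale p ha).IsometricSubspace E}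

end DeBranges

/-!
Put `K = K_E`. The kernel of `H(a ⊙_p E)` is `a ^ (2 p + 1) K(a z, a w)`, and an isometric inclusion
is a contraction on kernels, so that `a ^ (2 p + 1) K(a z, a z) ≤ K(z, z)`. Since `K(0, 0) > 0`
(`kernelFun_zero_pos`), evaluation at `z = 0` gives `a ^ (2 p + 1) ≤ 1` for every scale `a`
(`rpow_le_one`). The rest is an analysis of when equality holds.

If `H(E)` is finite-dimensional, then the inclusion is onto and equality holds
(`rpow_eq_one_of_finiteDimensional`). A scale `a > 1` forces finite dimension: iterating the
inequality on the diagonal shows that `K(z, z)` grows at most polynomially, so `H(E)` consists of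
polynomials of bounded degree (`finiteDimensional_of_one_lt`).

If equality holds for some `a ≠ 1`, then `K(·, 0)` and its dilation are elements of `H(E)` at distance
zero, so `K(·, 0)` is invariant under dilation by `a` and hence constant. Thus `B` is, up to a rotation
and scaling of the pair `(A, B)`, a multiple of `z`. Positivity of `K` makes an entire difference
quotient of `A` map the upper half-plane into a closed half-plane; such a function is affine
(`affine_of_im_nonneg`), and `K(z, w) = c + s z (conj w)` (`exists_kernelFun_eq_add_mul`). The inclusion is isometric on the
function `s z` only if `s = 0` (`kernelFun_eq_of_rpow_eq_one`). So equality for some `a ≠ 1` means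
`H(E) = span {1}`.

Consequently, if `dim H(E) > 1`, then `a ^ (2 p + 1) < 1` for all scales `a ≠ 1`, no scale exceeds `1`,
and `2 p + 1` is positive. If `dim H(E) = 1`, equality holds, so `p = -1/2` and
`H(E) = span {1}`. Conversely, a constant kernel is invariant under all rescalings of weight
`p = -1/2`.
-/

namespace DeBranges

open Complex ComplexConjugate

/-! ### Entire functions with nonnegative imaginary part on the upper half-plane -/

/-- On a circle around `c` the negative Fourier coefficients of an entire function vanish, so its
Taylor coefficients at `c` can be read off from the sine coefficients alone. -/
lemma integral_circleMap_mul_sin {f : ℂ → ℂ} (hf : Differentiable ℂ f) (c : ℂ) {r : ℝ} (hr : 0 < r)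
    (n : ℕ) :
    ∫ θ in (0 : ℝ)..2 * Real.pi, f (circleMap c r θ) * (Real.sin ((n + 1) * θ) : ℂ)
      = Real.pi * I * r ^ (n + 1) * (iteratedDeriv (n + 1) f c / (n + 1).factorial) := by
  have hr' : (r : ℂ) ≠ 0 := by exact_mod_cast hr.ne'
  have hne : ∀ z ∈ Metric.sphere c r, z - c ≠ 0 := by
    intro z hz h
    rw [mem_sphere_iff_norm, h, norm_zero] at hz
    exact hr.ne hz
  have h1 := hf.differentiableOn.circleIntegral_one_div_sub_center_pow_smul (c := c) hr (n + 1)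
  have h2 : ∮ z in C(c, r), (z - c) ^ n / r ^ (2 * n + 2) * f z = 0 :=
    circleIntegral_eq_zero_of_differentiable_on_off_countable hr.le Set.countable_empty
      (by have := hf.continuous; fun_prop) fun z _ => by fun_prop
  have hc : Continuous f := hf.continuous
  have h3 : ∮ z in C(c, r), ((1 / (z - c) ^ (n + 1 + 1)) • f z - (z - c) ^ n / r ^ (2 * n + 2) * f z)
      = (2 * Real.pi * I / (n + 1).factorial) • iteratedDeriv (n + 1) f c := by
    rw [circleIntegral.integral_sub, h1, h2, sub_zero]
    · refine ContinuousOn.circleIntegrable hr.le ?_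
      have : ∀ z ∈ Metric.sphere c r, (z - c) ^ (n + 1 + 1) ≠ 0 := fun z hz => pow_ne_zero _ (hne z hz)
      fun_prop (disch := assumption)
    · exact ContinuousOn.circleIntegrable hr.le (by fun_prop)
  rw [circleIntegral] at h3
  -- With `e = exp (i θ)` the weight is a multiple of `e ^ (-(n + 1)) - e ^ (n + 1)`, that is, a sine.
  have h4 : ∀ θ : ℝ, deriv (circleMap c r) θ • ((1 / (circleMap c r θ - c) ^ (n + 1 + 1)) •
      f (circleMap c r θ) - (circleMap c r θ - c) ^ n / r ^ (2 * n + 2) * f (circleMap c r θ))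
      = 2 / r ^ (n + 1) * (f (circleMap c r θ) * (Real.sin ((n + 1) * θ) : ℂ)) := by
    intro θ
    have e0 : exp (θ * I) ≠ 0 := exp_ne_zero _
    have e1 : exp (((n : ℂ) + 1) * θ * I) = exp (θ * I) ^ (n + 1) := by
      rw [← exp_nat_mul]; push_cast; ring_nf
    have e2 : exp (-(((n : ℂ) + 1) * θ) * I) = (exp (θ * I) ^ (n + 1))⁻¹ := by
      rw [← e1, ← exp_neg]; ring_nf
    have e3 : ((Real.sin ((n + 1) * θ) : ℝ) : ℂ)
        = ((exp (θ * I) ^ (n + 1))⁻¹ - exp (θ * I) ^ (n + 1)) * I / 2 := by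
      push_cast
      rw [Complex.sin, e1, e2]
    rw [e3, deriv_circleMap]
    simp only [circleMap, zero_add, add_sub_cancel_left, smul_eq_mul]
    field_simp
    ring
  simp_rw [h4] at h3
  rw [intervalIntegral.integral_const_mul] at h3
  have h5 : ((n + 1).factorial : ℂ) ≠ 0 := by exact_mod_cast (Nat.factorial_pos _).ne'
  rw [smul_eq_mul] at h3
  field_simp at h3 ⊢
  linear_combination h3

/-- An entire function that is real on the real line and maps the upper half-plane into its closure
is affine: `|sin 2θ| ≤ 2 |sin θ|` bounds the second Taylor coefficient at a real point by a constant
times `1 / r` for every radius `r`. -/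
lemma affine_of_im_nonneg {f : ℂ → ℂ} (hf : Differentiable ℂ f) (hsymm : ∀ z, f (conj z) = conj (f z))
    (him : ∀ z : ℂ, 0 < z.im → 0 ≤ (f z).im) : ∃ s t : ℂ, ∀ z, f z = s * z + t := by
  have hc : Continuous f := hf.continuous
  have hreal : ∀ x : ℝ, (f x).im = 0 := fun x => by
    have := congrArg Complex.im (hsymm x)
    simp only [conj_ofReal, conj_im] at this
    linarith
  have key : ∀ (x r : ℝ), 0 < r → ∀ n : ℕ,
      ∫ θ in (0 : ℝ)..2 * Real.pi, (f (circleMap x r θ)).im * Real.sin ((n + 1) * θ)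
        = Real.pi * r ^ (n + 1) * ((iteratedDeriv (n + 1) f x).re / (n + 1).factorial) := by
    intro x r hr n
    have h := congrArg Complex.im (integral_circleMap_mul_sin hf x hr n)
    have hi : IntervalIntegrable
        (fun θ : ℝ => f (circleMap x r θ) * (Real.sin ((n + 1) * θ) : ℂ)) MeasureTheory.volume
        0 (2 * Real.pi) := by
      apply Continuous.intervalIntegrable
      fun_prop
    have h' := Complex.imCLM.intervalIntegral_comp_comm hi
    simp only [imCLM_apply, im_mul_ofReal] at h'
    rw [h', h]
    have : (Real.pi * I * r ^ (n + 1) * (iteratedDeriv (n + 1) f x / (n + 1).factorial) : ℂ)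
        = ((Real.pi * r ^ (n + 1) / (n + 1).factorial : ℝ) : ℂ) * (iteratedDeriv (n + 1) f x * I) := by
      push_cast; ring
    rw [this, im_ofReal_mul, mul_I_im]
    ring
  -- `Im f` and `sin θ` have the same sign on both half-circles, by the symmetry of `f`.
  have hsign : ∀ (x r : ℝ), 0 < r → ∀ θ : ℝ, 0 ≤ (f (circleMap x r θ)).im * Real.sin θ := by
    intro x r hr θ
    have hz : (circleMap x r θ).im = r * Real.sin θ := by
      simp [circleMap, Complex.exp_ofReal_mul_I_im]
    rcases lt_trichotomy (Real.sin θ) 0 with h | h | h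
    · refine mul_nonneg_of_nonpos_of_nonpos ?_ h.le
      have h1 := him (conj (circleMap x r θ)) (by
        rw [conj_im, hz]
        have := mul_neg_of_pos_of_neg hr h
        linarith)
      rw [hsymm, conj_im] at h1
      linarith
    · simp [h]
    · exact mul_nonneg (him _ (hz ▸ mul_pos hr h)) h.le
  have hbound : ∀ x r : ℝ, 0 < r →
      |(iteratedDeriv 2 f x).re| * r ≤ 4 * (iteratedDeriv 1 f x).re := by
    intro x r hr
    have k1 := key x r hr 0
    have k2 := key x r hr 1
    have hcont : ∀ m : ℝ, IntervalIntegrable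
        (fun θ : ℝ => (f (circleMap x r θ)).im * Real.sin (m * θ)) MeasureTheory.volume
        0 (2 * Real.pi) := fun m => by
      apply Continuous.intervalIntegrable
      fun_prop
    have hpi : (0 : ℝ) ≤ 2 * Real.pi := by positivity
    have hle : |∫ θ in (0 : ℝ)..2 * Real.pi, (f (circleMap x r θ)).im * Real.sin (((1 : ℕ) + 1) * θ)|
        ≤ ∫ θ in (0 : ℝ)..2 * Real.pi, 2 * ((f (circleMap x r θ)).im * Real.sin (((0 : ℕ) + 1) * θ)) := by
      refine (intervalIntegral.abs_integral_le_integral_abs hpi).trans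
        (intervalIntegral.integral_mono_on hpi (hcont _).abs ((hcont _).const_mul _) fun θ _ => ?_)
      have h0 := hsign x r hr θ
      have : (f (circleMap x r θ)).im * Real.sin (((1 : ℕ) + 1) * θ)
          = 2 * Real.cos θ * ((f (circleMap x r θ)).im * Real.sin θ) := by
        rw [show (((1 : ℕ) : ℝ) + 1) * θ = 2 * θ by push_cast; ring, Real.sin_two_mul]
        ring
      rw [this, abs_mul, abs_of_nonneg h0, abs_mul, abs_two]
      simp only [Nat.cast_zero, zero_add, one_mul]
      have := Real.abs_cos_le_one θ
      gcongr
      linarith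
    rw [intervalIntegral.integral_const_mul, k1, k2] at hle
    norm_num [abs_mul, abs_div, abs_of_pos Real.pi_pos, abs_of_pos hr] at hle
    have hpr : 0 < Real.pi * r := by positivity
    rw [← mul_le_mul_iff_right₀ hpr]
    norm_num
    nlinarith
  have hd : Differentiable ℂ (deriv f) := hf.deriv
  have hsymm1 := deriv_conj_of_conj hsymm
  have hsymm2 := deriv_conj_of_conj hsymm1
  have hzero : ∀ x : ℝ, deriv (deriv f) x = 0 := by
    intro x
    have hre : (iteratedDeriv 2 f x).re = 0 := by
      by_contra hne
      have hpos := abs_pos.2 hne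
      have := hbound x (4 * |(iteratedDeriv 1 f x).re| / |(iteratedDeriv 2 f x).re| + 1)
        (by positivity)
      rw [mul_add, mul_div_cancel₀ _ hpos.ne', mul_one] at this
      have := le_abs_self (iteratedDeriv 1 f x).re
      linarith
    rw [iteratedDeriv_succ, iteratedDeriv_one] at hre
    refine Complex.ext hre ?_
    have := congrArg Complex.im (hsymm2 x)
    simp only [conj_ofReal, conj_im] at this
    simp only [zero_im]
    linarith
  -- Identity theorem on the real line.
  have hall : deriv (deriv f) = 0 := by
    have ha : AnalyticOnNhd ℂ (deriv (deriv f)) Set.univ := fun z _ => hd.deriv.analyticAt z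
    refine ha.eq_of_frequently_eq (z₀ := 0) (fun z _ => analyticAt_const) ?_
    have ht : Filter.Tendsto (fun x : ℝ => (x : ℂ)) (nhdsWithin 0 {0}ᶜ) (nhdsWithin 0 {0}ᶜ) := by
      refine tendsto_nhdsWithin_of_tendsto_nhds_of_eventually_within _ ?_ ?_
      · exact (Complex.continuous_ofReal.tendsto' 0 0 (by simp)).mono_left nhdsWithin_le_nhds
      · filter_upwards [self_mem_nhdsWithin] with x hx
        simpa using hx
    exact ht.frequently (Filter.Eventually.of_forall fun x => hzero x).frequently
  have hconst : ∀ z, deriv f z = deriv f 0 := fun z =>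
    is_const_of_deriv_eq_zero hd (fun w => congrFun hall w) z 0
  refine ⟨deriv f 0, f 0, fun z => ?_⟩
  have hdg : Differentiable ℂ fun z => f z - deriv f 0 * z := by fun_prop
  have := is_const_of_deriv_eq_zero hdg (fun w => by
    have h := ((hf w).hasDerivAt.sub ((hasDerivAt_id w).const_mul (deriv f 0))).deriv
    simp only [mul_one, hconst w, sub_self] at h
    exact h) z 0
  simp only [mul_zero, sub_zero] at this
  linear_combination this

lemma mem_span_pow_of_norm_le {f : ℂ → ℂ} (hf : Differentiable ℂ f) {C : ℝ} {m : ℕ}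
    (hC : ∀ z : ℂ, 1 ≤ ‖z‖ → ‖f z‖ ≤ C * ‖z‖ ^ m) :
    f ∈ Submodule.span ℂ ((fun (j : ℕ) (z : ℂ) => z ^ j) '' Set.Iic m) := by
  have hvan : ∀ n, m < n → iteratedDeriv n f 0 = 0 := by
    intro n hn
    obtain ⟨k, rfl⟩ := Nat.exists_eq_add_of_lt hn
    have hb : ∀ R : ℝ, 1 ≤ R → ‖iteratedDeriv (m + k + 1) f 0‖ * R
        ≤ (m + k + 1).factorial * C := by
      intro R hR
      have hR0 : 0 < R := by linarith
      have hC0 : 0 ≤ C := by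
        have := (norm_nonneg _).trans (hC 1 (by simp))
        simpa using this
      have h := norm_iteratedDeriv_le_of_forall_mem_sphere_norm_le (c := 0) (m + k + 1) hR0
        hf.diffContOnCl (C := C * R ^ m) fun z hz => by
          rw [mem_sphere_zero_iff_norm] at hz
          simpa [hz] using hC z (by rw [hz]; exact hR)
      rw [le_div_iff₀ (by positivity)] at h
      have h1 : R ^ m * R ≤ R ^ (m + k + 1) := by
        rw [← pow_succ]
        exact pow_le_pow_right₀ hR (by omega)
      have h2 : 0 < R ^ m := by positivity
      rw [← mul_le_mul_iff_left₀ h2]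
      calc _ = ‖iteratedDeriv (m + k + 1) f 0‖ * (R ^ m * R) := by ring
        _ ≤ ‖iteratedDeriv (m + k + 1) f 0‖ * R ^ (m + k + 1) := by gcongr
        _ ≤ _ := h
        _ = _ := by ring
    by_contra hne
    have hpos := norm_pos_iff.2 hne
    have := hb (|(m + k + 1).factorial * C| / ‖iteratedDeriv (m + k + 1) f 0‖ + 1)
      (by linarith [div_nonneg (abs_nonneg ((m + k + 1).factorial * C)) hpos.le])
    rw [mul_add, mul_div_cancel₀ _ hpos.ne'] at this
    linarith [le_abs_self ((m + k + 1).factorial * C)]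
  have hsum : f = ∑ j ∈ Finset.range (m + 1),
      (((j.factorial : ℂ)⁻¹ * iteratedDeriv j f 0) • fun z : ℂ => z ^ j) := by
    ext z
    rw [← taylorSeries_eq_of_entire' 0 z hf, tsum_eq_sum (s := Finset.range (m + 1))]
    · simp
    · intro n hn
      rw [Finset.mem_range, not_lt] at hn
      rw [hvan n (by omega)]
      simp
  rw [hsum]
  refine Submodule.sum_mem _ fun j hj => Submodule.smul_mem _ _ (Submodule.subset_span ⟨j, ?_, rfl⟩)
  rw [Finset.mem_range] at hj
  exact Set.mem_Iic.2 (by omega)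

/-! ### The kernel functions -/

namespace HermiteBiehler

variable (E E₁ E₂ : HermiteBiehler)

/-- The kernel function `K_E(·, w)` as an element of `H(E)`. -/
noncomputable def kernelElem (w : ℂ) : E.Space := RKHS.kerFun E.Space w 1

lemma kernelElem_apply (z w : ℂ) : E.kernelElem w z = kernelFun E.toFun z w := by
  rw [kernelElem, RKHS.kerFun_apply, RKHS.OfKernel.kernel_ofKernel]
  simp [kernel]

lemma inner_kernelElem (w : ℂ) (F : E.Space) : inner ℂ (E.kernelElem w) F = F w := by
  rw [kernelElem, RKHS.kerFun_inner]
  simp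

lemma inner_kernelElem_right (w : ℂ) (F : E.Space) : inner ℂ F (E.kernelElem w) = conj (F w) := by
  rw [← inner_conj_symm, inner_kernelElem]

lemma norm_kernelElem_sq (w : ℂ) : ‖E.kernelElem w‖ ^ 2 = (kernelFun E.toFun w w).re := by
  rw [← inner_self_eq_norm_sq (𝕜 := ℂ), inner_kernelElem, kernelElem_apply]
  rfl

lemma norm_apply_sq_le (F : E.Space) (w : ℂ) :
    ‖F w‖ ^ 2 ≤ ‖F‖ ^ 2 * (kernelFun E.toFun w w).re := by
  rw [← norm_kernelElem_sq, ← mul_pow, ← inner_kernelElem, mul_comm]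
  exact pow_le_pow_left₀ (norm_nonneg _) (norm_inner_le_norm _ _) 2

lemma norm_kernelFun_sq_le (z w : ℂ) : ‖kernelFun E.toFun z w‖ ^ 2
    ≤ (kernelFun E.toFun w w).re * (kernelFun E.toFun z z).re := by
  rw [← kernelElem_apply, ← norm_kernelElem_sq E w]
  exact E.norm_apply_sq_le _ _

lemma kernelFun_self_nonneg (w : ℂ) : 0 ≤ (kernelFun E.toFun w w).re := by
  rw [← norm_kernelElem_sq]
  positivity

lemma ofReal_re_kernelFun_self (w : ℂ) :
    ((kernelFun E.toFun w w).re : ℂ) = kernelFun E.toFun w w :=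
  conj_eq_iff_re.1 (kernelFun_conj _ _ _)

/-- If `K_E(0, 0)` vanished, then so would `K_E(·, 0)`, whence `|E| = |E^#|` on the upper
half-plane. -/
lemma kernelFun_zero_pos : 0 < (kernelFun E.toFun 0 0).re := by
  refine (E.kernelFun_self_nonneg 0).lt_of_ne' fun h => ?_
  have h1 := E.norm_kernelFun_sq_le I 0
  rw [h, zero_mul] at h1
  have h2 : kernelFun E.toFun I 0 = 0 := by
    rw [← norm_eq_zero, ← sq_eq_zero_iff]
    exact le_antisymm h1 (by positivity)
  have hI : (I : ℂ) ≠ conj 0 := by simp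
  rw [kernelFun_of_ne _ hI] at h2
  simp only [map_zero, sub_zero, div_eq_zero_iff, mul_eq_zero, I_ne_zero, or_false,
    OfNat.ofNat_ne_zero, false_or] at h2
  have h3 := congrArg norm (sub_eq_zero.1 h2)
  have h0 : E.toFun 0 ≠ 0 := by simpa using E.real_ne_zero 0
  simp only [norm_mul, RCLike.norm_conj, sharp, map_zero] at h3
  have h4 := E.norm_conj_lt I (by simp)
  exact h4.ne' (mul_right_cancel₀ (norm_ne_zero_iff.2 h0) h3)

lemma differentiable_kernelFun (w : ℂ) : Differentiable ℂ fun z => kernelFun E.toFun z w := by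
  set g : ℂ → ℂ := fun z => partB E.toFun z * partA E.toFun (conj w)
    - partB E.toFun (conj w) * partA E.toFun z with hg
  have hA := partA_differentiable E.entire
  have hB := partB_differentiable E.entire
  have hgd : Differentiable ℂ g := (hB.mul_const _).sub (hA.const_mul _)
  -- The numerator vanishes at `conj w`, so the kernel is a difference quotient.
  have heq : (fun z => kernelFun E.toFun z w) = dslope g (conj w) := by
    ext z
    by_cases h : z = conj w
    · rw [h, dslope_same, kernelFun, if_pos rfl]
      exact (((hB _).hasDerivAt.mul_const _).sub ((hA _).hasDerivAt.const_mul _)).deriv.symm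
    · rw [dslope_of_ne _ h, slope_def_field, kernelFun, if_neg h]
      simp only [hg]
      congr 1
      ring
  rw [heq, ← differentiableOn_univ, differentiableOn_dslope Filter.univ_mem]
  exact hgd.differentiableOn

/-- The diagonal of the kernel is bounded on bounded sets: near the real line the quotient defining
`K_E(z, z)` is controlled by the mean value inequality. -/
lemma exists_kernelFun_self_le (R : ℝ) : ∃ C, ∀ z : ℂ, ‖z‖ ≤ R → (kernelFun E.toFun z z).re ≤ C := by
  have hA := partA_differentiable E.entire
  have hB := partB_differentiable E.entire
  have hbd : ∀ {f : ℂ → ℂ}, Continuous f → ∃ M, ∀ z : ℂ, ‖z‖ ≤ R → ‖f z‖ ≤ M := fun hf => by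
    obtain ⟨M, hM⟩ := (isCompact_closedBall (0 : ℂ) R).exists_bound_of_continuousOn hf.continuousOn
    exact ⟨M, fun z hz => hM z (by simpa using hz)⟩
  obtain ⟨a, ha⟩ := hbd hA.continuous
  obtain ⟨b, hb⟩ := hbd hB.continuous
  obtain ⟨a', ha'⟩ := hbd hA.deriv.continuous
  obtain ⟨b', hb'⟩ := hbd hB.deriv.continuous
  refine ⟨b' * a + b * a', fun w hw => (re_le_norm _).trans ?_⟩
  have hw' : ‖conj w‖ ≤ R := by simpa using hw
  have hder : ∀ z : ℂ, ‖z‖ ≤ R → ‖deriv (partB E.toFun) z * partA E.toFun (conj w)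
      - partB E.toFun (conj w) * deriv (partA E.toFun) z‖ ≤ b' * a + b * a' := fun z hz => by
    have ha0 := (norm_nonneg _).trans (ha z hz)
    have hb0 := (norm_nonneg _).trans (hb z hz)
    have ha0' := (norm_nonneg _).trans (ha' z hz)
    have hb0' := (norm_nonneg _).trans (hb' z hz)
    refine (norm_sub_le _ _).trans ?_
    rw [norm_mul, norm_mul]
    gcongr
    exacts [hb' z hz, ha _ hw', hb _ hw', ha' z hz]
  rw [kernelFun]
  split_ifs with h
  · have := hder w hw
    rwa [← h] at this
  · rw [norm_div, div_le_iff₀ (norm_pos_iff.2 (sub_ne_zero.2 h))]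
    have := (convex_closedBall (0 : ℂ) R).norm_image_sub_le_of_norm_hasDerivWithin_le
      (f := fun z => partB E.toFun z * partA E.toFun (conj w)
        - partB E.toFun (conj w) * partA E.toFun z)
      (fun z _ => (((hB z).hasDerivAt.mul_const _).sub
        ((hA z).hasDerivAt.const_mul _)).hasDerivWithinAt)
      (fun z hz => hder z (by simpa using hz)) (x := conj w) (y := w) (by simpa using hw)
      (by simpa using hw)
    refine le_trans (le_of_eq (congrArg norm ?_)) this
    ring

lemma kernelFun_rescale (p : ℝ) {a : ℝ} (ha : 0 < a) (z w : ℂ) :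
    kernelFun (E.rescale p ha).toFun z w
      = ((a ^ (2 * p + 1) : ℝ) : ℂ) * kernelFun E.toFun (a * z) (a * w) := by
  have hpow : ((a ^ (2 * p + 1) : ℝ) : ℂ) = ((a ^ p : ℝ) : ℂ) ^ 2 * a := by
    rw [← ofReal_pow, ← ofReal_mul, Real.rpow_add ha, Real.rpow_one, ← Real.rpow_natCast (a ^ p),
      ← Real.rpow_mul ha.le]
    ring_nf
  have ha' : (a : ℂ) ≠ 0 := by exact_mod_cast ha.ne'
  have hA : ∀ z, partA (E.rescale p ha).toFun z = ((a ^ p : ℝ) : ℂ) * partA E.toFun (a * z) := by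
    intro z
    simp only [partA, sharp, rescale, weightedRescale, map_mul, conj_ofReal]
    ring
  have hB : ∀ z, partB (E.rescale p ha).toFun z = ((a ^ p : ℝ) : ℂ) * partB E.toFun (a * z) := by
    intro z
    simp only [partB, sharp, rescale, weightedRescale, map_mul, conj_ofReal]
    ring
  have hder : ∀ {f g : ℂ → ℂ}, Differentiable ℂ f →
      (∀ z, g z = ((a ^ p : ℝ) : ℂ) * f (a * z)) →
      ∀ z, deriv g z = ((a ^ p : ℝ) : ℂ) * (a * deriv f (a * z)) := by
    intro f g hf hg z
    rw [show g = fun z => ((a ^ p : ℝ) : ℂ) * f (a * z) from funext hg]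
    have h1 : HasDerivAt (fun z : ℂ => (a : ℂ) * z) a z := by
      simpa using (hasDerivAt_id z).const_mul (a : ℂ)
    have h2 := ((hf (a * z)).hasDerivAt.comp z h1).const_mul ((a ^ p : ℝ) : ℂ)
    rw [mul_comm (a : ℂ) (deriv f _)]
    exact h2.deriv
  have hiff : (a : ℂ) * z = conj (a * w) ↔ z = conj w := by
    rw [map_mul, conj_ofReal, mul_right_inj' ha']
  by_cases h : z = conj w
  · rw [kernelFun, kernelFun, if_pos h, if_pos (hiff.2 h),
      hder (partA_differentiable E.entire) hA, hder (partB_differentiable E.entire) hB, hA, hB, hpow]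
    ring
  · have h' : z - conj w ≠ 0 := sub_ne_zero.2 h
    rw [kernelFun, kernelFun, if_neg h, if_neg (mt hiff.1 h), hpow, hA, hB, hA, hB, map_mul,
      conj_ofReal, ← mul_sub]
    field_simp

/-! ### Isometric inclusions -/

variable {E₁ E₂}

/-- An isometric inclusion `H(E₁) ⊆ H(E₂)` as a linear isometry. -/
lemma IsometricSubspace.exists_linearIsometry (h : E₁.IsometricSubspace E₂) :
    ∃ J : E₁.Space →ₗᵢ[ℂ] E₂.Space, ∀ F z, J F z = F z := by
  choose J hJ hnorm using h
  refine ⟨{ toFun := J, map_add' := fun F G => ?_, map_smul' := fun c F => ?_, norm_map' := hnorm },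
    fun F z => congrFun (hJ F) z⟩
  · apply DFunLike.coe_injective
    rw [RKHS.coe_add, hJ, hJ, hJ, RKHS.coe_add]
  · apply DFunLike.coe_injective
    rw [RingHom.id_apply, RKHS.coe_smul, hJ, hJ, RKHS.coe_smul]

lemma isometricSubspace_of_kernelFun_eq
    (h : ∀ z w, kernelFun E₁.toFun z w = kernelFun E₂.toFun z w) : E₁.IsometricSubspace E₂ := by
  -- Both spaces are determined by their kernels, so equality of matrices allows a substitution.
  have hk : E₁.kernel = E₂.kernel := by
    ext z w
    simp [kernel, h]
  have gen : ∀ (K L : Matrix ℂ ℂ (ℂ →L[ℂ] ℂ)) [Fact K.PosSemidef] [Fact L.PosSemidef], K = L →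
      ∀ F : RKHS.OfKernel K, ∃ G : RKHS.OfKernel L, (G : ℂ → ℂ) = (F : ℂ → ℂ) ∧ ‖G‖ = ‖F‖ := by
    rintro K L _ _ rfl F
    exact ⟨F, rfl, rfl⟩
  exact gen _ _ hk

/-- The adjoint of an isometric inclusion maps kernel functions to kernel functions and is a
contraction. -/
lemma IsometricSubspace.kernelFun_self_le (h : E₁.IsometricSubspace E₂) (w : ℂ) :
    (kernelFun E₁.toFun w w).re ≤ (kernelFun E₂.toFun w w).re := by
  obtain ⟨J, hJ⟩ := h.exists_linearIsometry
  have h1 := E₂.norm_apply_sq_le (J (E₁.kernelElem w)) w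
  rw [hJ, J.norm_map, norm_kernelElem_sq, kernelElem_apply, ← ofReal_re_kernelFun_self E₁, norm_real,
    ofReal_re, Real.norm_eq_abs, sq_abs, sq] at h1
  rcases (E₁.kernelFun_self_nonneg w).eq_or_lt with h0 | h0
  · rw [← h0]
    exact E₂.kernelFun_self_nonneg w
  · exact le_of_mul_le_mul_left h1 h0

/-- If the kernels agree on the diagonal at `w`, then the isometric inclusion maps `K_{E₁}(·, w)` to
`K_{E₂}(·, w)`. -/
lemma IsometricSubspace.kernelFun_eq (h : E₁.IsometricSubspace E₂) {w : ℂ}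
    (hw : kernelFun E₁.toFun w w = kernelFun E₂.toFun w w) (z : ℂ) :
    kernelFun E₁.toFun z w = kernelFun E₂.toFun z w := by
  obtain ⟨J, hJ⟩ := h.exists_linearIsometry
  have h1 : ‖J (E₁.kernelElem w) - E₂.kernelElem w‖ ^ 2 = 0 := by
    rw [norm_sub_sq (𝕜 := ℂ), J.norm_map, norm_kernelElem_sq, norm_kernelElem_sq,
      inner_kernelElem_right, hJ, kernelElem_apply, hw]
    simp only [RCLike.re_to_complex, conj_re]
    ring
  rw [sq_eq_zero_iff, norm_eq_zero, sub_eq_zero] at h1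
  rw [← kernelElem_apply, ← kernelElem_apply, ← h1, hJ]

/-- If the isometric inclusion is onto, then it can be reversed, and the kernels agree on the
diagonal. -/
lemma IsometricSubspace.kernelFun_self_eq (h : E₁.IsometricSubspace E₂)
    (hs : ∀ G : E₂.Space, ∃ F : E₁.Space, (F : ℂ → ℂ) = G) (w : ℂ) :
    (kernelFun E₁.toFun w w).re = (kernelFun E₂.toFun w w).re := by
  refine le_antisymm (h.kernelFun_self_le w) (IsometricSubspace.kernelFun_self_le (fun G => ?_) w)
  obtain ⟨F, hF⟩ := hs G
  obtain ⟨G', hG', hn⟩ := h F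
  exact ⟨F, hF, by rw [← hn, DFunLike.coe_injective (hG'.trans hF)]⟩

variable {E}

/-! ### Finite-dimensional spaces -/

lemma eq_top_of_kernelElem_mem (S : Submodule ℂ E.Space) [FiniteDimensional ℂ S]
    (hS : ∀ w, E.kernelElem w ∈ S) : S = ⊤ := by
  rw [← Submodule.orthogonal_eq_bot_iff, Submodule.eq_bot_iff]
  intro F hF
  apply DFunLike.coe_injective
  ext w
  rw [← inner_kernelElem, RKHS.coe_zero]
  exact hF _ (hS w)

/-- If `H(E)` is finite-dimensional, then `H(a ⊙_p E)` has the same dimension, since the kernel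
functions of `H(E)` are rescaled kernel functions of `H(a ⊙_p E)`; so an isometric inclusion is an
equality. Comparing the kernels at the origin gives `a ^ (2 p + 1) = 1`. -/
lemma rpow_eq_one_of_finiteDimensional [FiniteDimensional ℂ E.Space] {p a : ℝ} {ha : 0 < a}
    (h : (E.rescale p ha).IsometricSubspace E) : a ^ (2 * p + 1) = 1 := by
  obtain ⟨J, hJ⟩ := h.exists_linearIsometry
  have hfin : FiniteDimensional ℂ (E.rescale p ha).Space :=
    Module.Finite.of_injective J.toLinearMap J.injective
  have ha' : (a : ℂ) ≠ 0 := by exact_mod_cast ha.ne'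
  have hpow : ((a ^ (2 * p + 1) : ℝ) : ℂ) ≠ 0 := by
    exact_mod_cast (Real.rpow_pos_of_pos ha _).ne'
  let V : (E.rescale p ha).Space →ₗ[ℂ] ℂ → ℂ :=
    { toFun := fun F z => F (z / a)
      map_add' := fun F G => by ext z; rw [RKHS.coe_add]; rfl
      map_smul' := fun c F => by ext z; rw [RKHS.coe_smul]; rfl }
  let ι : E.Space →ₗ[ℂ] ℂ → ℂ := (RKHS.coeCLM (H := E.Space) ℂ).toLinearMap
  have hι : Function.Injective ι := RKHS.coeCLM_injective
  have htop : (LinearMap.range V).comap ι = ⊤ := by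
    refine eq_top_of_kernelElem_mem _ fun w => ?_
    refine ⟨((a ^ (2 * p + 1) : ℝ) : ℂ)⁻¹ • (E.rescale p ha).kernelElem (w / a), ?_⟩
    ext z
    change (((a ^ (2 * p + 1) : ℝ) : ℂ)⁻¹ • (E.rescale p ha).kernelElem (w / a)) (z / a)
      = E.kernelElem w z
    rw [RKHS.coe_smul, Pi.smul_apply, kernelElem_apply, kernelElem_apply, kernelFun_rescale,
      mul_div_cancel₀ _ ha', mul_div_cancel₀ _ ha', smul_eq_mul, inv_mul_cancel_left₀ hpow]
  have hle : LinearMap.range ι ≤ LinearMap.range V := by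
    rintro _ ⟨F, rfl⟩
    have : F ∈ (LinearMap.range V).comap ι := htop ▸ Submodule.mem_top
    exact this
  have hdim : Module.finrank ℂ E.Space ≤ Module.finrank ℂ (E.rescale p ha).Space := by
    rw [← LinearMap.finrank_range_of_inj hι]
    exact (Submodule.finrank_mono hle).trans (LinearMap.finrank_range_le V)
  have hsurj : Function.Surjective J.toLinearMap :=
    (LinearMap.injective_iff_surjective_of_finrank_eq_finrank
      ((LinearMap.finrank_le_finrank_of_injective J.injective).antisymm hdim)).1 J.injective
  have h0 := h.kernelFun_self_eq (fun G => by
    obtain ⟨F, hF⟩ := hsurj G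
    refine ⟨F, ?_⟩
    rw [← hF]
    ext z
    exact (hJ F z).symm) 0
  rw [kernelFun_rescale, mul_zero, re_ofReal_mul] at h0
  exact mul_right_cancel₀ E.kernelFun_zero_pos.ne' (h0.trans (one_mul _).symm)

/-- For `a > 1` the inequality `a ^ (2 p + 1) K_E(a z, a z) ≤ K_E(z, z)` forces polynomial growth, so
that `H(E)` consists of polynomials of bounded degree. -/
lemma finiteDimensional_of_one_lt {p a : ℝ} {ha : 0 < a} (h : (E.rescale p ha).IsometricSubspace E)
    (h1 : 1 < a) : FiniteDimensional ℂ E.Space := by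
  have hμ : 0 < a ^ (2 * p + 1) := Real.rpow_pos_of_pos ha _
  obtain ⟨m, hm⟩ := pow_unbounded_of_one_lt (a ^ (2 * p + 1))⁻¹ h1
  obtain ⟨C, hC⟩ := E.exists_kernelFun_self_le a
  have hstep : ∀ z : ℂ, (kernelFun E.toFun (a * z) (a * z)).re
      ≤ a ^ m * (kernelFun E.toFun z z).re := fun z => by
    have h2 := h.kernelFun_self_le z
    rw [kernelFun_rescale, re_ofReal_mul, ← le_inv_mul_iff₀ hμ] at h2
    exact h2.trans (mul_le_mul_of_nonneg_right hm.le (E.kernelFun_self_nonneg z))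
  have hiter : ∀ (n : ℕ) (z : ℂ), (kernelFun E.toFun (a ^ n * z) (a ^ n * z)).re
      ≤ (a ^ n) ^ m * (kernelFun E.toFun z z).re := by
    intro n
    induction n with
    | zero => intro z; simp
    | succ n ih =>
      intro z
      rw [pow_succ' (a : ℂ), mul_assoc]
      refine (hstep _).trans ?_
      rw [pow_succ' a, mul_pow, mul_assoc]
      exact mul_le_mul_of_nonneg_left (ih z) (by positivity)
  have hdiag : ∀ z : ℂ, 1 ≤ ‖z‖ → (kernelFun E.toFun z z).re ≤ C * ‖z‖ ^ m := by
    intro z hz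
    -- Scale `z` back into the disc of radius `a`, where the diagonal is at most `C`.
    obtain ⟨n, hn1, hn2⟩ := exists_nat_pow_near hz h1
    have han : 0 < a ^ n := by positivity
    have han' : (a : ℂ) ^ n ≠ 0 := by exact_mod_cast han.ne'
    have hu : ‖z / (a : ℂ) ^ n‖ ≤ a := by
      rw [norm_div, norm_pow, norm_real, Real.norm_of_nonneg ha.le, div_le_iff₀ han, ← pow_succ']
      exact hn2.le
    have h3 := hiter n (z / (a : ℂ) ^ n)
    rw [mul_div_cancel₀ _ han'] at h3
    have hC0 : 0 ≤ C := (E.kernelFun_self_nonneg _).trans (hC _ hu)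
    calc _ ≤ _ := h3
      _ ≤ ‖z‖ ^ m * C := mul_le_mul (pow_le_pow_left₀ han.le hn1 m) (hC _ hu)
          (E.kernelFun_self_nonneg _) (by positivity)
      _ = _ := mul_comm _ _
  have hgrowth : ∀ w z : ℂ, 1 ≤ ‖z‖ → ‖kernelFun E.toFun z w‖
      ≤ (1 + (kernelFun E.toFun w w).re * C) * ‖z‖ ^ m := by
    intro w z hz
    have hw := E.kernelFun_self_nonneg w
    have hC0 : 0 ≤ C := (E.kernelFun_self_nonneg 0).trans (hC 0 (by simpa using ha.le))
    have hpow : 1 ≤ ‖z‖ ^ m := one_le_pow₀ hz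
    have h4 : 0 ≤ (kernelFun E.toFun w w).re * C := mul_nonneg hw hC0
    refine (sq_le_sq₀ (norm_nonneg _) (by positivity)).1 ?_
    calc _ ≤ _ := E.norm_kernelFun_sq_le z w
      _ ≤ (kernelFun E.toFun w w).re * (C * ‖z‖ ^ m) := by gcongr; exact hdiag z hz
      _ ≤ _ := by
        nlinarith [mul_le_mul_of_nonneg_left hpow (zero_le_one.trans hpow),
          mul_nonneg h4 (zero_le_one.trans hpow), mul_nonneg h4 h4]
  let ι : E.Space →ₗ[ℂ] ℂ → ℂ := (RKHS.coeCLM (H := E.Space) ℂ).toLinearMap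
  have hι : Function.Injective ι := RKHS.coeCLM_injective
  set P : Submodule ℂ (ℂ → ℂ) :=
    Submodule.span ℂ ((fun (j : ℕ) (z : ℂ) => z ^ j) '' Set.Iic m)
  have hP : FiniteDimensional ℂ P := FiniteDimensional.span_of_finite ℂ ((Set.finite_Iic m).image _)
  have hfin : FiniteDimensional ℂ (P.comap ι) :=
    Module.Finite.of_injective (ι.restrict (p := P.comap ι) (q := P) fun _ hF => hF)
      fun F G hFG => Subtype.ext (hι (congrArg Subtype.val hFG))
  have htop : P.comap ι = ⊤ := eq_top_of_kernelElem_mem _ fun w => by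
    have : ι (E.kernelElem w) = fun z => kernelFun E.toFun z w :=
      funext fun z => E.kernelElem_apply z w
    rw [Submodule.mem_comap, this]
    exact mem_span_pow_of_norm_le (E.differentiable_kernelFun w) (hgrowth w)
  rw [htop] at hfin
  exact Module.finite_def.2 (Module.Finite.iff_fg.1 hfin)

/-! ### Equality in `a ^ (2 p + 1) ≤ 1` -/

/-- If `K_E(·, 0)` is constant, then after a rotation of `(A, B)` and a scaling the function `B` is a
multiple of `z`. Positivity of the kernel then says that the difference quotient of `A` at the origin
has imaginary part of constant sign on the upper half-plane, hence is affine. -/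
lemma exists_kernelFun_eq_add_mul (hc : ∀ z, kernelFun E.toFun z 0 = kernelFun E.toFun 0 0) :
    ∃ s : ℂ, ∀ z w, kernelFun E.toFun z w = kernelFun E.toFun 0 0 + s * (z * conj w) := by
  set A := partA E.toFun with hAdef
  set B := partB E.toFun with hBdef
  have hA : Differentiable ℂ A := partA_differentiable E.entire
  have hB : Differentiable ℂ B := partB_differentiable E.entire
  have hAc : ∀ z, A (conj z) = conj (A z) := partA_conj _
  have hBc : ∀ z, B (conj z) = conj (B z) := partB_conj _
  have hA0 : conj (A 0) = A 0 := by rw [← hAc, map_zero]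
  have hB0 : conj (B 0) = B 0 := by rw [← hBc, map_zero]
  set c : ℝ := (kernelFun E.toFun 0 0).re with hcdef
  have hcK : kernelFun E.toFun 0 0 = c := (E.ofReal_re_kernelFun_self 0).symm
  have hc0 : 0 < c := E.kernelFun_zero_pos
  set ρ : ℝ := normSq (E.toFun 0) with hρdef
  have hρ0 : 0 < ρ := normSq_pos.2 (by simpa using E.real_ne_zero 0)
  have hρ0' : (ρ : ℂ) ≠ 0 := by exact_mod_cast hρ0.ne'
  have hρ : (ρ : ℂ) = A 0 ^ 2 + B 0 ^ 2 := by
    rw [hρdef, normSq_eq_conj_mul_self]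
    simp only [hAdef, hBdef, partA, partB, sharp, map_zero]
    linear_combination (-1 / 4 : ℂ) * (E.toFun 0 - conj (E.toFun 0)) ^ 2 * I_sq
  have hlin : ∀ z, B z * A 0 - B 0 * A z = c * z := by
    intro z
    by_cases hz : z = 0
    · subst hz; ring
    · have h1 := hc z
      rw [hcK, kernelFun, if_neg (by simpa using hz), map_zero, sub_zero, div_eq_iff hz] at h1
      exact h1
  -- `A'` is the counterpart of `A` in the rotated pair; that of `B` is `c z` by `hlin`.
  set A' : ℂ → ℂ := fun z => A 0 * A z + B 0 * B z with hA'def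
  have hA' : Differentiable ℂ A' := (hA.const_mul _).add (hB.const_mul _)
  have hA'c : ∀ z, A' (conj z) = conj (A' z) := fun z => by
    simp only [hA'def, map_add, map_mul, hAc, hBc, hA0, hB0]
  have hA'0 : A' 0 = ρ := by rw [hρ]; ring
  set q : ℂ → ℂ := dslope A' 0 with hqdef
  have hq : Differentiable ℂ q := by
    rw [← differentiableOn_univ, hqdef, differentiableOn_dslope Filter.univ_mem]
    exact hA'.differentiableOn
  have hzq : ∀ z, A' z = ρ + z * q z := fun z => by
    have h1 := sub_smul_dslope A' 0 z
    rw [sub_zero, smul_eq_mul, hA'0] at h1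
    rw [h1]
    ring
  have hqc : ∀ z, q (conj z) = conj (q z) := by
    intro z
    by_cases hz : z = 0
    · subst hz
      have h1 := deriv_conj_of_conj hA'c 0
      rw [map_zero] at h1 ⊢
      rwa [hqdef, dslope_same]
    · have hz' : conj z ≠ 0 := by simpa using hz
      apply mul_left_cancel₀ hz'
      have h1 := hA'c z
      rw [hzq, hzq, map_add, map_mul, conj_ofReal] at h1
      exact add_left_cancel h1
  have hK : ∀ z w, z ≠ conj w → kernelFun E.toFun z w
      = c + c / ρ * (z * conj w) * ((q (conj w) - q z) / (z - conj w)) := by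
    intro z w hzw
    have hd : z - conj w ≠ 0 := sub_ne_zero.2 hzw
    rw [kernelFun, if_neg hzw, div_eq_iff hd]
    have h1 : ρ * (B z * A (conj w) - B (conj w) * A z)
        = c * (z * A' (conj w) - conj w * A' z) := by
      rw [hρ]
      linear_combination A' (conj w) * hlin z - A' z * hlin (conj w)
    rw [hzq, hzq] at h1
    field_simp
    linear_combination h1
  obtain ⟨s, t, hst⟩ := affine_of_im_nonneg (f := fun z => -q z) hq.neg
    (fun z => by rw [hqc, map_neg]) (fun w hw => by
      have hwne : w ≠ conj w := fun e => hw.ne' (conj_eq_iff_im.1 e.symm)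
      have h1 := E.norm_kernelFun_sq_le w 0
      rw [hc, hcK, norm_real, Real.norm_of_nonneg hc0.le, ofReal_re, sq] at h1
      -- Cauchy-Schwarz against `K(·, 0) = c` gives `c ≤ K(w, w)`.
      have h2 := le_of_mul_le_mul_left h1 hc0
      have h3 : (q (conj w) - q w) / (w - conj w) = ((-(q w).im / w.im : ℝ) : ℂ) := by
        have hw' : (w.im : ℂ) ≠ 0 := by exact_mod_cast hw.ne'
        rw [hqc, ← neg_sub, sub_conj, sub_conj]
        push_cast
        field_simp
      have h4 : kernelFun E.toFun w w
          = ((c + c / ρ * normSq w * (-(q w).im / w.im) : ℝ) : ℂ) := by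
        rw [hK w w hwne, h3, mul_conj]
        push_cast
        ring
      rw [h4, ofReal_re, le_add_iff_nonneg_right] at h2
      have h5 : 0 < c / ρ * normSq w := by
        have : 0 < normSq w := normSq_pos.2 fun e => by simp [e] at hw
        positivity
      have h6 := nonneg_of_mul_nonneg_right h2 h5
      have h7 := mul_nonneg h6 hw.le
      rwa [div_mul_cancel₀ _ hw.ne'] at h7)
  refine ⟨c / ρ * s, fun z w => ?_⟩
  rw [hcK]
  have hoff : ∀ z, z ≠ conj w →
      kernelFun E.toFun z w = c + c / ρ * s * (z * conj w) := by
    intro z hzw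
    have hd : z - conj w ≠ 0 := sub_ne_zero.2 hzw
    have h1 : (q (conj w) - q z) / (z - conj w) = s := by
      rw [div_eq_iff hd]
      linear_combination hst z - hst (conj w)
    rw [hK z w hzw, h1]
    ring
  exact congrFun (Continuous.ext_on (dense_compl_singleton (conj w))
    (E.differentiable_kernelFun w).continuous (by fun_prop) hoff) z

lemma _root_.Continuous.eq_apply_zero_of_mul_invariant {f : ℂ → ℂ} (hf : Continuous f) {a : ℝ}
    (ha : 0 < a) (ha1 : a ≠ 1) (h : ∀ z, f (a * z) = f z) (z : ℂ) : f z = f 0 := by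
  have main : ∀ b : ℝ, 0 < b → b < 1 → (∀ z, f (b * z) = f z) → f z = f 0 := by
    intro b hb hb1 hfb
    have hn : ∀ n : ℕ, f ((b ^ n : ℝ) * z) = f z := by
      intro n
      induction n with
      | zero => simp
      | succ n ih =>
        rw [pow_succ', ofReal_mul, mul_assoc, hfb, ih]
    have hlim : Filter.Tendsto (fun n : ℕ => f ((b ^ n : ℝ) * z)) Filter.atTop (nhds (f 0)) := by
      refine (hf.tendsto 0).comp ?_
      have h1 := (continuous_ofReal.tendsto 0).comp (tendsto_pow_atTop_nhds_zero_of_lt_one hb.le hb1)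
      simpa using h1.mul_const z
    simp only [hn] at hlim
    exact tendsto_nhds_unique tendsto_const_nhds hlim
  rcases lt_or_gt_of_ne ha1 with h1 | h1
  · exact main a ha h1 h
  · refine main a⁻¹ (inv_pos.2 ha) (inv_lt_one_of_one_lt₀ h1) fun z => ?_
    have ha' : (a : ℂ) ≠ 0 := by exact_mod_cast ha.ne'
    rw [← h (_ * z), ofReal_inv, mul_inv_cancel_left₀ ha']

/-- If `a ^ (2 p + 1) = 1` and `a ≠ 1`, then the kernel is `c + s z (conj w)`. For `s ≠ 0` the
function `z` would have norm `s ^ (-1/2)` in `H(E)` and `a⁻¹ s ^ (-1/2)` in `H(a ⊙_p E)`, so the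
kernel is constant. -/
lemma kernelFun_eq_of_rpow_eq_one {p a : ℝ} {ha : 0 < a} (h : (E.rescale p ha).IsometricSubspace E)
    (hp : a ^ (2 * p + 1) = 1) (ha1 : a ≠ 1) (z w : ℂ) :
    kernelFun E.toFun z w = kernelFun E.toFun 0 0 := by
  have hres : ∀ z w, kernelFun (E.rescale p ha).toFun z w = kernelFun E.toFun (a * z) (a * w) :=
    fun z w => by rw [kernelFun_rescale, hp, ofReal_one, one_mul]
  -- The two kernels agree at `(0, 0)`, so `K(a z, 0) = K(z, 0)`.
  have h0 : ∀ z, kernelFun E.toFun (a * z) 0 = kernelFun E.toFun z 0 := fun z => by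
    have := h.kernelFun_eq (w := 0) (by rw [hres, mul_zero]) z
    rwa [hres, mul_zero] at this
  obtain ⟨s, hs⟩ := exists_kernelFun_eq_add_mul fun z =>
    (E.differentiable_kernelFun 0).continuous.eq_apply_zero_of_mul_invariant ha ha1 h0 z
  set c := kernelFun E.toFun 0 0
  -- `F` and `G` are the functions `a ^ 2 s z` in `H(a ⊙_p E)` and `s z` in `H(E)`.
  set F := (E.rescale p ha).kernelElem 1 - (E.rescale p ha).kernelElem 0 with hF
  set G := E.kernelElem 1 - E.kernelElem 0 with hG
  have hFz : ∀ z, F z = a ^ 2 * (s * z) := fun z => by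
    rw [hF, RKHS.coe_sub, Pi.sub_apply, kernelElem_apply, kernelElem_apply, hres, hres, hs, hs]
    simp
    ring
  have hGz : ∀ z, G z = s * z := fun z => by
    rw [hG, RKHS.coe_sub, Pi.sub_apply, kernelElem_apply, kernelElem_apply, hs, hs]
    simp
  have hFn : ‖F‖ ^ 2 = a ^ 2 * s.re := by
    rw [← inner_self_eq_norm_sq (𝕜 := ℂ)]
    nth_rewrite 1 [hF]
    rw [inner_sub_left, inner_kernelElem, inner_kernelElem, hFz, hFz, ← ofReal_pow]
    simp only [mul_zero, sub_zero, mul_one, RCLike.re_to_complex, re_ofReal_mul]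
  have hGn : ‖G‖ ^ 2 = s.re := by
    rw [← inner_self_eq_norm_sq (𝕜 := ℂ)]
    nth_rewrite 1 [hG]
    rw [inner_sub_left, inner_kernelElem, inner_kernelElem, hGz, hGz]
    simp
  obtain ⟨J, hJ⟩ := h.exists_linearIsometry
  have hJF : J F = ((a ^ 2 : ℝ) : ℂ) • G := by
    apply DFunLike.coe_injective
    ext z
    rw [hJ, hFz, RKHS.coe_smul, Pi.smul_apply, hGz, smul_eq_mul, ofReal_pow]
  have hn := congrArg (fun x => ‖x‖ ^ 2) hJF
  simp only [J.norm_map, norm_smul, norm_real, mul_pow] at hn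
  rw [hFn, hGn, Real.norm_of_nonneg (by positivity)] at hn
  have hsre : s.re = 0 := by
    by_contra hne
    have h2 := mul_right_cancel₀ hne hn
    have ha2 : a ^ 2 ≠ 0 := by positivity
    have h3 : a ^ 2 * 1 = a ^ 2 * a ^ 2 := by rw [mul_one, ← sq]; exact h2
    have h4 := mul_left_cancel₀ ha2 h3
    exact ha1 ((pow_eq_one_iff_of_nonneg ha.le two_ne_zero).1 h4.symm)
  have hG0 : G = 0 := by rwa [hsre, sq_eq_zero_iff, norm_eq_zero] at hGn
  have hs0 : s = 0 := by
    have := hGz 1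
    rwa [hG0, RKHS.coe_zero, Pi.zero_apply, mul_one, eq_comm] at this
  rw [hs, hs0, zero_mul, add_zero]

/-! ### Constant kernels -/

lemma functions_eq_span_one_iff :
    E.functions = (Submodule.span ℂ {(1 : ℂ → ℂ)} : Set (ℂ → ℂ)) ↔
      ∀ z w, kernelFun E.toFun z w = kernelFun E.toFun 0 0 := by
  constructor
  · intro h
    have hconst : ∀ z w, kernelFun E.toFun z w = kernelFun E.toFun 0 w := by
      intro z w
      have hmem : (E.kernelElem w : ℂ → ℂ) ∈ E.functions := ⟨_, rfl⟩
      rw [h, SetLike.mem_coe, Submodule.mem_span_singleton] at hmem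
      obtain ⟨c, hc⟩ := hmem
      rw [← kernelElem_apply, ← kernelElem_apply, ← hc]
      rfl
    intro z w
    rw [hconst, ← kernelFun_conj, hconst, kernelFun_conj]
  · intro h
    have hk : ∀ w, E.kernelElem w = E.kernelElem 0 := fun w => by
      apply DFunLike.coe_injective
      ext z
      rw [kernelElem_apply, kernelElem_apply, h, h z]
    have hc0 : kernelFun E.toFun 0 0 ≠ 0 := fun e => E.kernelFun_zero_pos.ne' (by rw [e, zero_re])
    ext f
    rw [SetLike.mem_coe, Submodule.mem_span_singleton]
    constructor
    · rintro ⟨F, rfl⟩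
      refine ⟨F 0, ?_⟩
      ext z
      simp [← inner_kernelElem, hk z]
    · rintro ⟨c, rfl⟩
      refine ⟨(c / kernelFun E.toFun 0 0) • E.kernelElem 0, ?_⟩
      ext z
      simp only [RKHS.coe_smul, Pi.smul_apply, kernelElem_apply, h z, smul_eq_mul, Pi.one_apply]
      field_simp

lemma rank_le_one_of_kernelFun_eq (h : ∀ z w, kernelFun E.toFun z w = kernelFun E.toFun 0 0) :
    Module.rank ℂ E.Space ≤ 1 := by
  have hfun := functions_eq_span_one_iff.2 h
  obtain ⟨F₀, hF₀⟩ : (1 : ℂ → ℂ) ∈ E.functions := by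
    rw [hfun]
    exact Submodule.mem_span_singleton_self _
  rw [rank_le_one_iff]
  refine ⟨F₀, fun F => ?_⟩
  have hF : (F : ℂ → ℂ) ∈ E.functions := ⟨F, rfl⟩
  rw [hfun, SetLike.mem_coe, Submodule.mem_span_singleton] at hF
  obtain ⟨c, hc⟩ := hF
  refine ⟨c, DFunLike.coe_injective ?_⟩
  rw [RKHS.coe_smul, ← hc, ← hF₀]

/-! ### Scales -/

lemma one_mem_isometricScales (p : ℝ) : 1 ∈ isometricScales p E :=
  ⟨one_pos, isometricSubspace_of_kernelFun_eq fun z w => by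
    rw [kernelFun_rescale, Real.one_rpow, ofReal_one, one_mul, one_mul, one_mul]⟩

lemma exists_ne_one_of_isometricScales_ne {p : ℝ} (h : isometricScales p E ≠ {1}) :
    ∃ a ∈ isometricScales p E, a ≠ 1 := by
  by_contra! hall
  exact h (Set.Subset.antisymm (fun a ha => hall a ha)
    (Set.singleton_subset_iff.2 (one_mem_isometricScales p)))

lemma rpow_le_one {p a : ℝ} {ha : 0 < a} (h : (E.rescale p ha).IsometricSubspace E) :
    a ^ (2 * p + 1) ≤ 1 := by
  have h0 := h.kernelFun_self_le 0
  rw [kernelFun_rescale, mul_zero, re_ofReal_mul] at h0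
  exact le_of_mul_le_mul_right (h0.trans_eq (one_mul _).symm) E.kernelFun_zero_pos

end HermiteBiehler

end DeBranges

open DeBranges HermiteBiehler in
theorem mainTheorem6 (E : DeBranges.HermiteBiehler) :
    (1 < Module.rank ℂ E.Space → ∀ p : ℝ, DeBranges.isometricScales p E ≠ {1} →
      -(1 / 2) < p ∧ DeBranges.isometricScales p E ⊆ Set.Ioc 0 1) ∧
    (Module.rank ℂ E.Space = 1 → ∀ p : ℝ, DeBranges.isometricScales p E ≠ {1} →
      p = -(1 / 2) ∧ E.functions = (Submodule.span ℂ {(1 : ℂ → ℂ)} : Set (ℂ → ℂ))) ∧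
    (E.functions = (Submodule.span ℂ {(1 : ℂ → ℂ)} : Set (ℂ → ℂ)) →
      DeBranges.isometricScales (-(1 / 2)) E = Set.Ioi 0) := by
  refine ⟨fun hrank p hp => ?_, fun hrank p hp => ?_, fun hfun => ?_⟩
  · have hne : ∀ {a : ℝ} (ha : 0 < a), (E.rescale p ha).IsometricSubspace E → a ≠ 1 →
        a ^ (2 * p + 1) ≠ 1 := fun ha h ha1 hpow =>
      hrank.not_ge (rank_le_one_of_kernelFun_eq (kernelFun_eq_of_rpow_eq_one h hpow ha1))
    have hsub : isometricScales p E ⊆ Set.Ioc 0 1 := by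
      rintro a ⟨ha, h⟩
      refine ⟨ha, not_lt.1 fun h1 => hne ha h h1.ne' ?_⟩
      have := finiteDimensional_of_one_lt h h1
      exact rpow_eq_one_of_finiteDimensional h
    refine ⟨?_, hsub⟩
    obtain ⟨a, ⟨ha, h⟩, ha1⟩ := exists_ne_one_of_isometricScales_ne hp
    have halt : a < 1 := lt_of_le_of_ne (hsub ⟨ha, h⟩).2 ha1
    by_contra! hle
    refine (rpow_le_one h).not_gt (lt_of_le_of_ne ?_ (hne ha h ha1).symm)
    exact Real.one_le_rpow_of_pos_of_le_one_of_nonpos ha halt.le (by linarith)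
  · obtain ⟨a, ⟨ha, h⟩, ha1⟩ := exists_ne_one_of_isometricScales_ne hp
    have : FiniteDimensional ℂ E.Space :=
      Module.finite_of_rank_eq_one hrank
    have hpow := rpow_eq_one_of_finiteDimensional h
    refine ⟨?_, functions_eq_span_one_iff.2 (kernelFun_eq_of_rpow_eq_one h hpow ha1)⟩
    have := (Real.rpow_right_inj ha ha1).1 (hpow.trans (Real.rpow_zero a).symm)
    linarith
  · ext a
    refine ⟨fun ⟨ha, _⟩ => ha, fun ha =>
      ⟨Set.mem_Ioi.1 ha, isometricSubspace_of_kernelFun_eq fun z w => ?_⟩⟩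
    have h := functions_eq_span_one_iff.1 hfun
    rw [kernelFun_rescale, h, h z]
    norm_num
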